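/- **Setting.** $M\ge 1$ players face MDPs $\mathcal M_p=(H,\mathcal S,\mathcal A,p_0,\mathbb P_p,r_p)$, $p\in[M]$, that share the episode length $H$, the state space $\mathcal S$ with $|\mathcal S|=S$, the action space $\mathcal A$ with $|\mathcal A|=A$ and the initial distribution $p_0$. The MDPs are layered: $\mathcal S$ is the disjoint union of $\mathcal S_1,\dots,\mathcal S_H$, $p_0$ is supported on $\mathcal S_1$, and for $s\in\mathcal S_h$ the transition distribution $\mathbb P_p(\cdot\mid s,a)$ is supported on $\mathcal S_{h+1}$, where $\mathcal S_{H+1}=\{\bot\}$ with a terminal state $\bot\notin\mathcal S$. The rewards have distributions $r_p(\cdot\mid s,a)$ on $[0,1]$ with means $R_p(s,a)$. For $\pi:\mathcal S\to\mathcal A$ let $V_p^\pi$ be the value function given by $V_p^\pi(\bot)=0$ and $V_p^\pi(s)=R_p(s,\pi(s))+\sum_{s'}\mathbb P_p(s'\mid s,\pi(s))V_p^\pi(s')$, and let $V_p^\star,Q_p^\star$ be given by $V_p^\star(\bot)=0$, $Q_p^\star(s,a)=R_p(s,a)+\sum_{s'}\mathbb P_p(s'\mid s,a)V_p^\star(s')$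 and $V_p^\star(s)=\max_a Q_p^\star(s,a)$. Put $V_{0,p}^{\pi}=\mathbb E_{s\sim p_0}V_p^{\pi}(s)$, $V_{0,p}^{\star}=\mathbb E_{s\sim p_0}V_p^{\star}(s)$ and $\mathrm{gap}_p(s,a)=V_p^\star(s)-Q_p^\star(s,a)$. For $\epsilon\ge 0$, the collection is an *$\epsilon$-MPERL problem instance* if $|R_p(s,a)-R_q(s,a)|\le\epsilon$ and $\|\mathbb P_p(\cdot\mid s,a)-\mathbb P_q(\cdot\mid s,a)\|_1\le\epsilon/H$ for all $p,q\in[M]$ and $(s,a)\in\mathcal S\times\mathcal A$; and $\mathcal I_{\epsilon}=\{(s,a):\exists p\in[M],\ \mathrm{gap}_p(s,a)>96H\epsilon\}$. An *algorithm* knows the layers and $p_0$, but not $\mathbb P_p$ and $r_p$. In each episode $k=1,\dots,K$ it chooses, possibly at random, a policy $\pi^k(p):\mathcal S\to\mathcal A$ for every player $p$, as a function of the history of all players up to episode $k-1$ (their policies, visited states, actions and rewards) and of its internal randomness; then the players independently execute these policies for one episode in their respective MDPs. Its collective regret is $\mathrm{Reg}_{\mathrm{Alg}}(K)=\sum_{p=1}^M\sum_{k=1}^K\bigl(V_{0,p}^\star-V_{0,p}^{\pi^k(p)}\bigr)$.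 **Theorem (gap-independent lower bound).** There is an absolute constant $c>0$ such that the following holds. For all integers $A\ge 2$, $H\ge 2$, $S\ge 4H$, $K\ge SA$, $M\ge 1$ and $l,l^C\ge 0$ with $l+l^C=SA$ and $l\le SA-4(S+HA)$, there exists $\epsilon\ge 0$ such that for every algorithm $\mathrm{Alg}$ there exists an $\epsilon$-MPERL problem instance with $S$ states, $A$ actions, $M$ players and episode length $H$ such that $\bigl|\mathcal I_{\epsilon/(192H)}\bigr|\ge l$ and $$\mathbb E\bigl[\mathrm{Reg}_{\mathrm{Alg}}(K)\bigr]\ \ge\ c\,\Bigl(M\sqrt{H^2\,l^C K}+\sqrt{M H^2\, l K}\Bigr).$$ -/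

import Mathlib

open MeasureTheory ProbabilityTheory
open scoped ENNReal

noncomputable section

namespace MPERL

/-- The part of the environment that the players know in advance and that is common to all
players: the partition of the `S` states into `H` layers (layer `h ∈ {1, …, H}` of the
mathematics is `h - 1 : Fin H` here) and the initial state distribution, supported on the
first layer. -/
structure Frame (S H : ℕ) where
  layer : Fin S → Fin H
  init : PMF (Fin S)
  init_layer : ∀ s, init s ≠ 0 → (layer s : ℕ) = 0

/-- The (zero-based) index of the layer of a state; `none` is the terminal state `⊥`, the only
element of the layer after the last one. -/
def Frame.layerOf {S H : ℕ} (F : Frame S H) : Option (Fin S) → ℕ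
  | some s => F.layer s
  | none => H

/-- A collection of `M` layered episodic MDPs with state space `Fin S`, action space `Fin A` and
episode length `H`, sharing layers and initial distribution: transition probabilities with
values in `Δ(𝒮 ∪ {⊥})` that lead from each layer to the next one, and reward distributions in
`Δ([0,1])`. -/
structure Environment (S A H M : ℕ) extends Frame S H where
  trans : Fin M → Fin S → Fin A → PMF (Option (Fin S))
  trans_layer : ∀ p s a x, trans p s a x ≠ 0 →
    toFrame.layerOf x = (layer s : ℕ) + 1
  reward : Fin M → Fin S → Fin A → ProbabilityMeasure (Set.Icc (0 : ℝ) 1)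

/-- A deterministic, history-independent policy. -/
abbrev Policy (S A : ℕ) := Fin S → Fin A

/-- One policy for each player. -/
abbrev JointPolicy (S A M : ℕ) := Fin M → Policy S A

/-- The trajectory `(s_h, a_h, r_h)`, `h = 1, …, H`, of one player in one episode. -/
abbrev Trajectory (S A H : ℕ) := Fin H → (Fin S × Fin A) × Set.Icc (0 : ℝ) 1

/-- What happens in one episode: the policies executed, and the trajectories of all players. -/
abbrev Episode (S A H M : ℕ) := JointPolicy S A M × (Fin M → Trajectory S A H)

/-- The interaction history of the first `k` episodes. -/
abbrev History (S A H M k : ℕ) := Fin k → Episode S A H M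

/-- A (possibly randomized) algorithm. Knowing the layers and the initial distribution, it draws
the policies of all players for the next episode from a distribution that depends measurably on
the whole past of all players. The past includes the previously drawn policies, so that the
random choices made in different episodes, and by different players, may be correlated in any
way. -/
structure Algorithm (S A H M : ℕ) where
  next : Frame S H → (k : ℕ) → Kernel (History S A H M k) (JointPolicy S A M)
  markov : ∀ F k, IsMarkovKernel (next F k)

instance {S A H M : ℕ} (alg : Algorithm S A H M) (F : Frame S H) (k : ℕ) :
    IsMarkovKernel (alg.next F k) := alg.markov F k

/-- The probability that a chain on `Fin S ∪ {⊥}` with transition probabilities `T`, started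
from a draw of `d`, visits exactly the listed states, in this order, before it reaches `⊥`. -/
def pathMass {S : ℕ} (T : Fin S → PMF (Option (Fin S))) :
    PMF (Option (Fin S)) → List (Fin S) → ℝ≥0∞
  | d, [] => d none
  | d, s :: t => d (some s) * pathMass T (T s) t

namespace Environment

variable {S A H M : ℕ} (I : Environment S A H M)

/-! ### Value functions, gaps, similarity -/

/-- The expected immediate reward `R_p(s,a)`. -/
def meanReward (p : Fin M) (s : Fin S) (a : Fin A) : ℝ :=
  ∫ x, (x : ℝ) ∂(I.reward p s a : Measure (Set.Icc (0 : ℝ) 1))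

/-- `R_p(s,a) + (ℙ_p f)(s,a)`, where `f(⊥) = 0`. -/
def backup (p : Fin M) (f : Fin S → ℝ) (s : Fin S) (a : Fin A) : ℝ :=
  I.meanReward p s a + ∑ s' : Fin S, (I.trans p s a (some s')).toReal * f s'

/-- Bellman recursion for `π`, with `n` steps to go. -/
def valueToGo (p : Fin M) (π : Policy S A) : ℕ → Fin S → ℝ
  | 0, _ => 0
  | n + 1, s => I.backup p (valueToGo p π n) s (π s)

/-- Bellman optimality recursion, with `n` steps to go. -/
def optValueToGo (p : Fin M) : ℕ → Fin S → ℝ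
  | 0, _ => 0
  | n + 1, s => ⨆ a : Fin A, I.backup p (optValueToGo p n) s a

/-- `V_p^π(s)`: in layer `h` there are `H - h + 1` steps to go. -/
def value (p : Fin M) (π : Policy S A) (s : Fin S) : ℝ :=
  I.valueToGo p π (H - I.layer s) s

/-- `V_p^⋆(s)`. -/
def optValue (p : Fin M) (s : Fin S) : ℝ :=
  I.optValueToGo p (H - I.layer s) s

/-- `Q_p^⋆(s,a)`. -/
def optQ (p : Fin M) (s : Fin S) (a : Fin A) : ℝ :=
  I.backup p (I.optValue p) s a

/-- The suboptimality gap `gap_p(s,a)`. -/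
def gap (p : Fin M) (s : Fin S) (a : Fin A) : ℝ :=
  I.optValue p s - I.optQ p s a

/-- The expected reward `V_{0,p}^π` of an episode. -/
def initValue (p : Fin M) (π : Policy S A) : ℝ :=
  ∑ s : Fin S, (I.init s).toReal * I.value p π s

/-- The optimal expected reward `V_{0,p}^⋆`. -/
def optInitValue (p : Fin M) : ℝ :=
  ∑ s : Fin S, (I.init s).toReal * I.optValue p s

/-- The MDPs are `ε`-dissimilar, that is, form an `ε`-MPERL problem instance. -/
def IsDissimilar (ε : ℝ) : Prop :=
  0 ≤ ε ∧ ∀ (p q : Fin M) (s : Fin S) (a : Fin A),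
    |I.meanReward p s a - I.meanReward q s a| ≤ ε ∧
    ∑ x : Option (Fin S), |(I.trans p s a x).toReal - (I.trans q s a x).toReal| ≤ ε / H

/-- The set `ℐ_ε` of subpar state-action pairs. -/
def subpar (ε : ℝ) : Set (Fin S × Fin A) :=
  {z | ∃ p : Fin M, 96 * (H : ℝ) * ε < I.gap p z.1 z.2}

/-! ### The interaction process -/

lemma sum_pathMass (T : Fin S → PMF (Option (Fin S)))
    (hT : ∀ s x, T s x ≠ 0 → I.layerOf x = (I.layer s : ℕ) + 1) (n : ℕ) :
    ∀ d : PMF (Option (Fin S)), (∀ x, d x ≠ 0 → I.layerOf x + n = H) →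
      ∑ x : Fin n → Fin S, pathMass T d (List.ofFn x) = 1 := by
  induction n with
  | zero =>
    intro d hd
    have h0 : ∀ s, d (some s) = 0 := by
      intro s
      by_contra h
      have h1 := hd _ h
      have h2 := (I.layer s).isLt
      simp only [Frame.layerOf] at h1
      omega
    have h1 := d.tsum_coe
    rw [tsum_fintype, Fintype.sum_option] at h1
    simpa [pathMass, h0] using h1
  | succ n ih =>
    intro d hd
    have h0 : d none = 0 := by
      by_contra h
      have h1 := hd _ h
      simp only [Frame.layerOf] at h1
      omega
    have h1 := d.tsum_coe
    rw [tsum_fintype, Fintype.sum_option, h0, zero_add] at h1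
    rw [← (Fin.consEquiv (fun _ : Fin (n + 1) => Fin S)).sum_comp, Fintype.sum_prod_type,
      ← h1]
    refine Finset.sum_congr rfl fun s _ => ?_
    have h2 : ∀ x : Fin n → Fin S,
        pathMass T d (List.ofFn (Fin.consEquiv (fun _ : Fin (n + 1) => Fin S) (s, x))) =
          d (some s) * pathMass T (T s) (List.ofFn x) := by
      intro x
      change pathMass T d (List.ofFn (Fin.cons s x : Fin (n + 1) → Fin S)) = _
      rw [List.ofFn_cons, pathMass]
    simp only [h2]
    rw [← Finset.mul_sum]
    by_cases hs : d (some s) = 0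
    · simp [hs]
    · rw [ih (T s), mul_one]
      intro x hx
      have h2 := hT s x hx
      have h3 : (I.layer s : ℕ) + (n + 1) = H := hd _ hs
      omega

/-- The law of the states `s_1, …, s_H` that player `p` visits in an episode with policy `π`. -/
def statePath (p : Fin M) (π : Policy S A) : PMF (Fin H → Fin S) :=
  PMF.ofFintype
    (fun x => pathMass (fun s => I.trans p s (π s)) (I.init.map some) (List.ofFn x))
    (by
      refine I.sum_pathMass _ (fun s x hx => I.trans_layer p s (π s) x hx) H _ ?_
      intro x hx
      rw [← PMF.mem_support_iff, PMF.support_map] at hx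
      obtain ⟨s, hs, rfl⟩ := hx
      have := I.init_layer s ((PMF.mem_support_iff _ _).1 hs)
      change (I.layer s : ℕ) + H = H
      omega)

/-- The law of the trajectory of player `p` in an episode with policy `π`: given the states, the
rewards `r_h ∼ r_p(· | s_h, a_h)` are independent. -/
def trajectoryLaw (p : Fin M) (π : Policy S A) : Measure (Trajectory S A H) :=
  ∑ x : Fin H → Fin S, I.statePath p π x •
    Measure.pi fun h => (Measure.dirac (x h, π (x h))).prod
      (I.reward p (x h) (π (x h)) : Measure (Set.Icc (0 : ℝ) 1))

instance (p : Fin M) (π : Policy S A) : IsProbabilityMeasure (I.trajectoryLaw p π) := by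
  constructor
  have h := (I.statePath p π).tsum_coe
  rw [tsum_fintype] at h
  simpa [trajectoryLaw] using h

/-- Given their policies, the players run one episode independently of each other. -/
def runKernel : Kernel (JointPolicy S A M) (Fin M → Trajectory S A H) where
  toFun π := Measure.pi fun p => I.trajectoryLaw p (π p)
  measurable' := Measurable.of_discrete

instance : IsMarkovKernel I.runKernel :=
  ⟨fun π => by dsimp [runKernel]; infer_instance⟩

/-- The law of the next episode, given the history of the first `k` episodes. -/
def episodeKernel (alg : Algorithm S A H M) (k : ℕ) :
    Kernel (History S A H M k) (Episode S A H M) :=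
  alg.next I.toFrame k ⊗ₖ I.runKernel.prodMkLeft (History S A H M k)

instance (alg : Algorithm S A H M) (k : ℕ) : IsMarkovKernel (I.episodeKernel alg k) := by
  unfold episodeKernel; infer_instance

/-- The law of the history of the first `k` episodes when running the algorithm. -/
def historyLaw (alg : Algorithm S A H M) : (k : ℕ) → Measure (History S A H M k)
  | 0 => Measure.dirac Fin.elim0
  | k + 1 => (historyLaw alg k ⊗ₘ I.episodeKernel alg k).map fun z => Fin.snoc z.1 z.2

lemma measurable_snoc (k : ℕ) : Measurable fun z : History S A H M k × Episode S A H M =>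
    (Fin.snoc z.1 z.2 : History S A H M (k + 1)) := by
  refine measurable_pi_lambda _ fun i => ?_
  refine Fin.lastCases ?_ (fun j => ?_) i
  · simpa using measurable_snd
  · simp only [Fin.snoc_castSucc]
    exact (measurable_pi_apply j).comp measurable_fst

instance (alg : Algorithm S A H M) (k : ℕ) : IsProbabilityMeasure (I.historyLaw alg k) := by
  induction k with
  | zero => unfold historyLaw; infer_instance
  | succ k ih =>
    unfold historyLaw
    exact Measure.isProbabilityMeasure_map (measurable_snoc k).aemeasurable

/-- The collective regret over `K` episodes. -/
def regret (K : ℕ) (ω : History S A H M K) : ℝ :=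
  ∑ p : Fin M, ∑ k : Fin K, (I.optInitValue p - I.initValue p ((ω k).1 p))

/-- The expected collective regret of an algorithm over `K` episodes. -/
def expectedRegret (alg : Algorithm S A H M) (K : ℕ) : ℝ :=
  ∫ ω, I.regret K ω ∂(I.historyLaw alg K)

end Environment

end MPERL

end

/-!
Why the lower bound holds. The hard instances are contextual bandits written as layered MDPs
(`banditEnv`). The first layer consists of `N = S - 2 (H - 1)` contexts, one of which is drawn
uniformly; an action leads to a good chain of states, which pays `1` in each of the remaining
`H - 1` steps, or to a bad chain, which pays nothing. A policy thus pulls one arm per context, whose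
mean `q p s a` is multiplied by `H - 1`.

In each context, `m` actions have mean `1 / 2`, except for a hidden one with mean `1 / 2 + Δ`; the
other actions have mean `0`. The hidden action is common to all players of a class. If `B` bounds
the size of the classes, an arm of bias `Δ` cannot be told from a fair one unless it is pulled about
`Δ⁻²` times, and the players of one class visit a context `K B / N` times on average. Hence for
`Δ ≈ √(N m / (K B))` and a random hidden action, any algorithm chooses wrongly in a quarter of all
episodes (`exists_expectedRegret_ge`), at the price of `(H - 1) Δ M K / 4 ≈ M H √(N m K / B)`.

* With classes of one player (`exists_hard_of_le`) the players are `2 H Δ`-dissimilar and `B = 1`.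
  The number of actions of mean `0` is chosen such that these account for `l` subpar pairs and still
  `N m ≥ lC / 2`. This gives the first term of the bound.
* With a single class (`exists_hard_of_ge`) all players face the same MDP, the dissimilarity is `0`,
  `m = A`, `B = M`, and all actions but the hidden ones are subpar. This gives the second term.

Which of the two terms is larger decides between the constructions, so the dissimilarity depends
on the parameters only and not on the algorithm.

The information-theoretic part is elementary. Since the rewards are functions of the states, the law
of the history is a finite sum of point masses (`Environment.historyLaw_eq`), and the divergence of
the laws under two environments decomposes over episodes, players and contexts
(`Environment.relEntropy_historyProb`, `relEntropy_statePath`). A weak Pinsker inequality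
(`sum_le_sum_add_sqrt_relEntropy`) then compares the environment with the environment in which the
hidden action of one class in one context is removed (`armProb_update_le`). Because a policy fixes
the actions in all contexts before the context is drawn, it suffices to bound probabilities of choices
of policies in single episodes, and no concentration of the number of visits is needed.
-/

noncomputable section

namespace MPERL

/-! ### Relative entropy on finite types -/

/-- The relative entropy (Kullback-Leibler divergence) of two mass functions on a finite type. -/
def relEntropy {α : Type*} [Fintype α] (p q : α → ℝ) : ℝ :=
  ∑ x, p x * Real.log (p x / q x)

lemma sq_sum_sqrt_sub_le_relEntropy {α : Type*} [Fintype α] {p q : α → ℝ}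
    (hp : ∀ x, 0 ≤ p x) (hq : ∀ x, 0 ≤ q x) (hp1 : ∑ x, p x = 1) (hq1 : ∑ x, q x = 1)
    (hpq : ∀ x, q x = 0 → p x = 0) :
    ∑ x, (√(q x) - √(p x)) ^ 2 ≤ relEntropy p q := by
  have h : ∀ x, q x + p x - 2 * (√(q x) * √(p x)) + (p x - q x) ≤
      p x * Real.log (p x / q x) := by
    intro x
    rcases eq_or_lt_of_le (hp x) with h0 | h0
    · simp [← h0]
    · have hq0 : 0 < q x := lt_of_le_of_ne (hq x) fun h => h0.ne' (hpq x h.symm)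
      have h1 : Real.log (p x / q x) = -(2 * Real.log (√(q x) / √(p x))) := by
        rw [Real.log_div h0.ne' hq0.ne', Real.log_div (by positivity) (by positivity),
          Real.log_sqrt hq0.le, Real.log_sqrt h0.le]
        ring
      have h2 := Real.log_le_sub_one_of_pos (x := √(q x) / √(p x)) (by positivity)
      have h3 : p x * (√(q x) / √(p x)) = √(q x) * √(p x) := by
        have := Real.sq_sqrt h0.le
        field_simp
        rw [this]
      rw [h1]
      nlinarith
  have h2 : ∀ x, (√(q x) - √(p x)) ^ 2 = q x + p x - 2 * (√(q x) * √(p x)) + (p x - q x)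
      + (q x - p x) := by
    intro x
    have h1 := Real.sq_sqrt (hp x)
    have h2 := Real.sq_sqrt (hq x)
    nlinarith
  calc ∑ x, (√(q x) - √(p x)) ^ 2
      = ∑ x, (q x + p x - 2 * (√(q x) * √(p x)) + (p x - q x)) := by
        simp_rw [h2]
        rw [Finset.sum_add_distrib, Finset.sum_sub_distrib q p, hp1, hq1]
        ring
    _ ≤ _ := Finset.sum_le_sum fun x _ => h x

/-- A weak form of Pinsker's inequality, through the Hellinger distance. -/
lemma sum_le_sum_add_sqrt_relEntropy {α : Type*} [Fintype α] {p q : α → ℝ}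
    (hp : ∀ x, 0 ≤ p x) (hq : ∀ x, 0 ≤ q x) (hp1 : ∑ x, p x = 1) (hq1 : ∑ x, q x = 1)
    (hpq : ∀ x, q x = 0 → p x = 0) (E : Finset α) :
    ∑ x ∈ E, q x ≤ ∑ x ∈ E, p x + √(relEntropy p q) := by
  have hH := sq_sum_sqrt_sub_le_relEntropy hp hq hp1 hq1 hpq
  have h1 : ∑ x, |q x - p x| ≤ 2 * √(relEntropy p q) := by
    have h2 : ∀ x, |q x - p x| = |√(q x) - √(p x)| * (√(q x) + √(p x)) := by
      intro x
      rw [← abs_of_nonneg (a := √(q x) + √(p x)) (by positivity), ← abs_mul]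
      congr 1
      have h1 := Real.sq_sqrt (hp x)
      have h2 := Real.sq_sqrt (hq x)
      nlinarith
    have h3 : ∑ x, (√(q x) + √(p x)) ^ 2 ≤ 4 := by
      have : ∀ x, (√(q x) + √(p x)) ^ 2 ≤ 2 * q x + 2 * p x := by
        intro x
        have h1 := Real.sq_sqrt (hp x)
        have h2 := Real.sq_sqrt (hq x)
        nlinarith [sq_nonneg (√(q x) - √(p x))]
      calc _ ≤ ∑ x, (2 * q x + 2 * p x) := Finset.sum_le_sum fun x _ => this x
        _ = 4 := by
          rw [Finset.sum_add_distrib, ← Finset.mul_sum, ← Finset.mul_sum, hp1, hq1]; norm_num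
    have hD : 0 ≤ relEntropy p q :=
      le_trans (Finset.sum_nonneg fun x _ => sq_nonneg _) hH
    have h4 := Finset.sum_mul_sq_le_sq_mul_sq Finset.univ (fun x => |√(q x) - √(p x)|)
      (fun x => √(q x) + √(p x))
    simp only [sq_abs] at h4
    simp_rw [h2]
    refine abs_le_of_sq_le_sq' ?_ (by positivity) |>.2
    rw [mul_pow, Real.sq_sqrt hD]
    calc _ ≤ _ := h4
      _ ≤ relEntropy p q * 4 := mul_le_mul hH h3 (Finset.sum_nonneg fun x _ => sq_nonneg _) hD
      _ = _ := by ring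
  classical
  -- Over all of `α` the differences `q - p` sum to `0`, so each event sees at most half of them.
  have h5 : ∑ x ∈ E, (q x - p x) + ∑ x ∈ Eᶜ, (q x - p x) = 0 := by
    rw [Finset.sum_add_sum_compl, Finset.sum_sub_distrib, hp1, hq1, sub_self]
  have h6 : ∑ x ∈ E, (q x - p x) ≤ ∑ x ∈ E, |q x - p x| :=
    Finset.sum_le_sum fun x _ => le_abs_self _
  have h7 : -∑ x ∈ Eᶜ, (q x - p x) ≤ ∑ x ∈ Eᶜ, |q x - p x| := by
    rw [← Finset.sum_neg_distrib]
    exact Finset.sum_le_sum fun x _ => neg_le_abs _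
  have h8 := Finset.sum_add_sum_compl E fun x => |q x - p x|
  have h9 : ∑ x ∈ E, (q x - p x) = ∑ x ∈ E, q x - ∑ x ∈ E, p x := Finset.sum_sub_distrib _ _
  linarith

/-- Chain rule for the relative entropy of the laws of pairs. -/
lemma relEntropy_mul {α β : Type*} [Fintype α] [Fintype β] {p q : α → ℝ} {κ η : α → β → ℝ}
    (hκ : ∀ x, p x ≠ 0 → ∑ y, κ x y = 1) (hpq : ∀ x, q x = 0 → p x = 0)
    (hκη : ∀ x y, η x y = 0 → κ x y = 0) :
    relEntropy (fun z : α × β => p z.1 * κ z.1 z.2) (fun z => q z.1 * η z.1 z.2) =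
      relEntropy p q + ∑ x, p x * relEntropy (κ x) (η x) := by
  have h : ∀ x y, p x * κ x y * Real.log (p x * κ x y / (q x * η x y)) =
      κ x y * (p x * Real.log (p x / q x)) + p x * (κ x y * Real.log (κ x y / η x y)) := by
    intro x y
    by_cases hp : p x = 0
    · simp [hp]
    by_cases hk : κ x y = 0
    · simp [hk]
    have hq : q x ≠ 0 := fun h => hp (hpq x h)
    have he : η x y ≠ 0 := fun h => hk (hκη x y h)
    rw [mul_div_mul_comm, Real.log_mul (div_ne_zero hp hq) (div_ne_zero hk he)]
    ring
  simp only [relEntropy]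
  rw [Fintype.sum_prod_type, ← Finset.sum_add_distrib]
  refine Finset.sum_congr rfl fun x _ => ?_
  simp_rw [h]
  rw [Finset.sum_add_distrib, ← Finset.sum_mul, ← Finset.mul_sum]
  by_cases hp : p x = 0
  · simp [hp]
  · rw [hκ x hp, one_mul]

/-- The expectation, under a product law, of a sum of functions of the coordinates. -/
lemma sum_prod_mul_sum {ι α : Type*} [Fintype ι] [Fintype α] [DecidableEq ι]
    (p : ι → α → ℝ) (hp1 : ∀ i, ∑ y, p i y = 1) (f : ι → α → ℝ) :
    ∑ x : ι → α, (∏ i, p i (x i)) * ∑ j, f j (x j) = ∑ j, ∑ y, p j y * f j y := by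
  simp_rw [Finset.mul_sum]
  rw [Finset.sum_comm]
  refine Finset.sum_congr rfl fun j _ => ?_
  have h : ∀ x : ι → α, (∏ i, p i (x i)) * f j (x j) =
      ∏ i, (p i (x i) * if i = j then f i (x i) else 1) := by
    intro x
    rw [Finset.prod_mul_distrib, Finset.prod_ite_eq' Finset.univ j]
    simp
  simp_rw [h]
  rw [← Fintype.piFinset_univ,
    ← Finset.prod_univ_sum (fun _ : ι => (Finset.univ : Finset α))
      (fun i y => p i y * if i = j then f i y else 1)]
  rw [Finset.prod_eq_single j]
  · simp
  · intro i _ hi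
    simp [hi, hp1]
  · simp

/-- The relative entropy of product laws is the sum of the relative entropies. -/
lemma relEntropy_pi {ι α : Type*} [Fintype ι] [Fintype α] [DecidableEq ι] {p q : ι → α → ℝ}
    (hp1 : ∀ i, ∑ y, p i y = 1) (hpq : ∀ i y, q i y = 0 → p i y = 0) :
    relEntropy (fun x : ι → α => ∏ i, p i (x i)) (fun x => ∏ i, q i (x i)) =
      ∑ i, relEntropy (p i) (q i) := by
  simp only [relEntropy]
  rw [← sum_prod_mul_sum p hp1 fun i y => Real.log (p i y / q i y)]
  refine Finset.sum_congr rfl fun x _ => ?_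
  by_cases h : ∏ i, p i (x i) = 0
  · simp [h]
  · congr 1
    have h := Finset.prod_ne_zero_iff.1 h
    rw [← Finset.prod_div_distrib, Real.log_prod]
    intro i hi
    exact div_ne_zero (h i hi) fun h' => h i hi (hpq i _ h')

/-- The relative entropy of coins with success probabilities `a` and `b`. -/
def coinEntropy (a b : ℝ) : ℝ :=
  a * Real.log (a / b) + (1 - a) * Real.log ((1 - a) / (1 - b))

lemma coinEntropy_self (a : ℝ) : coinEntropy a a = 0 := by
  have h : ∀ b : ℝ, b * Real.log (b / b) = 0 := fun b => by
    by_cases hb : b = 0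
    · simp [hb]
    · simp [div_self hb]
  rw [coinEntropy, h, h, add_zero]

lemma coinEntropy_half_le {Δ : ℝ} (h0 : 0 ≤ Δ) (h : Δ ≤ 1 / 4) :
    coinEntropy (1 / 2) (1 / 2 + Δ) ≤ 4 * Δ ^ 2 := by
  rw [coinEntropy, show (1 : ℝ) - 1 / 2 = 1 / 2 by norm_num]
  have ha : 0 < 1 / 2 + Δ := by positivity
  have hb : 0 < 1 - (1 / 2 + Δ) := by linarith
  rw [← mul_add, ← Real.log_mul (by positivity) (by positivity)]
  have h1 := Real.log_le_sub_one_of_pos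
    (x := (1 / 2) / (1 / 2 + Δ) * ((1 / 2) / (1 - (1 / 2 + Δ)))) (by positivity)
  have h2 : (1 / 2) / (1 / 2 + Δ) * ((1 / 2) / (1 - (1 / 2 + Δ))) - 1 ≤ 8 * Δ ^ 2 := by
    rw [div_mul_div_comm, sub_le_iff_le_add, div_le_iff₀ (by positivity)]
    have : Δ ^ 2 ≤ 1 / 16 := by nlinarith
    nlinarith [sq_nonneg Δ, mul_nonneg (sq_nonneg Δ) (sub_nonneg.2 this)]
  linarith

/-- Averaging over all functions can be done by first resampling the value at one point. -/
lemma sum_sum_update {ι β : Type*} [Fintype ι] [DecidableEq ι] [Fintype β]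
    (i : ι) (f : (ι → β) → ℝ) :
    ∑ θ : ι → β, ∑ a, f (Function.update θ i a) = Fintype.card β * ∑ θ, f θ := by
  have h : ∀ (b a : β) (r : {j // j ≠ i} → β),
      Function.update ((Equiv.funSplitAt i β).symm (b, r)) i a =
        (Equiv.funSplitAt i β).symm (a, r) := by
    intro b a r
    ext j
    by_cases hj : j = i
    · subst hj; simp
    · simp [hj]
  rw [← (Equiv.funSplitAt i β).symm.sum_comp, ← (Equiv.funSplitAt i β).symm.sum_comp f]
  rw [Fintype.sum_prod_type, Fintype.sum_prod_type]
  simp_rw [h]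
  rw [Finset.sum_const, Finset.card_univ, nsmul_eq_mul, Finset.sum_comm]

/-! ### Contextual bandits with delayed rewards as layered MDPs -/

/-- The contexts: the states that are not among the `2 * (H - 1)` chain states. -/
def contexts (S H : ℕ) : Finset (Fin S) := {s | 2 * (H - 1) ≤ (s : ℕ)}

lemma card_contexts {S H : ℕ} (hS : 4 * H ≤ S) : (contexts S H).card = S - 2 * (H - 1) := by
  have h : contexts S H = (Finset.univ.filter fun s : Fin S => (s : ℕ) < 2 * (H - 1))ᶜ := by
    ext s; simp [contexts]
  rw [h, Finset.card_compl, Fintype.card_fin, Fin.card_filter_val_lt]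
  congr 1
  omega

lemma contexts_nonempty {S H : ℕ} (hH : 2 ≤ H) (hS : 4 * H ≤ S) : (contexts S H).Nonempty := by
  rw [← Finset.card_pos, card_contexts hS]
  omega

/-- The first layer consists of the contexts, one of which is drawn uniformly. Each later layer
`h ∈ {1, …, H - 1}` (zero-based) consists of a bad state `2 * (h - 1)` and a good state
`2 * (h - 1) + 1`. -/
def contextFrame {S H : ℕ} (hH : 2 ≤ H) (hS : 4 * H ≤ S) : Frame S H where
  layer s := if h : (s : ℕ) < 2 * (H - 1) then ⟨s / 2 + 1, by omega⟩ else ⟨0, by omega⟩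
  init := PMF.uniformOfFinset (contexts S H) (contexts_nonempty hH hS)
  init_layer s hs := by
    rw [← PMF.mem_support_iff, PMF.mem_support_uniformOfFinset_iff] at hs
    simp only [contexts, Finset.mem_filter, Finset.mem_univ, true_and] at hs
    rw [dif_neg (by omega)]

/-- The bad state of layer `1`. -/
def badState {S H : ℕ} (hH : 2 ≤ H) (hS : 4 * H ≤ S) : Fin S := ⟨0, by omega⟩

/-- The good state of layer `1`. -/
def goodState {S H : ℕ} (hH : 2 ≤ H) (hS : 4 * H ≤ S) : Fin S := ⟨1, by omega⟩

/-- The successor of a chain state: the state of the same kind in the next layer, if any. -/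
def chainNext {S : ℕ} (H : ℕ) (s : Fin S) : Option (Fin S) :=
  if h : (s : ℕ) + 2 < 2 * (H - 1) ∧ (s : ℕ) + 2 < S then some ⟨s + 2, h.2⟩ else none

/-- The transition distribution of a context under an action that leads to the good state with
probability `q`. -/
def contextTrans {S H : ℕ} (hH : 2 ≤ H) (hS : 4 * H ≤ S) (q : unitInterval) :
    PMF (Option (Fin S)) :=
  PMF.ofFintype
    (fun x => if x = some (goodState hH hS) then ENNReal.ofReal q
      else if x = some (badState hH hS) then ENNReal.ofReal (1 - q) else 0)
    (by
      have hne : badState hH hS ≠ goodState hH hS := by simp [badState, goodState]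
      rw [← Finset.sum_subset
        (Finset.subset_univ {some (goodState hH hS), some (badState hH hS)})]
      · rw [Finset.sum_pair (by simpa using hne.symm)]
        have := q.2.1
        have := q.2.2
        simp only [if_true, Option.some.injEq, hne, if_false]
        rw [← ENNReal.ofReal_add (by linarith) (by linarith)]
        simp
      · intro x _ hx
        simp only [Finset.mem_insert, Finset.mem_singleton, not_or] at hx
        simp [hx.1, hx.2])

/-- The reward collected in a state: `1` in the good states and `0` elsewhere. -/
def stateReward {S : ℕ} (H : ℕ) (s : Fin S) : Set.Icc (0 : ℝ) 1 :=
  if (s : ℕ) < 2 * (H - 1) ∧ (s : ℕ) % 2 = 1 then 1 else 0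

/-- The environment in which player `p`, choosing action `a` in context `s`, moves to the good
state of layer `1` with probability `q p s a` and to the bad one otherwise. From there on, nothing
depends on the actions, and the reward is `1` in each good state and `0` in each bad state. -/
def banditEnv {S A H M : ℕ} (hH : 2 ≤ H) (hS : 4 * H ≤ S)
    (q : Fin M → Fin S → Fin A → unitInterval) : Environment S A H M where
  toFrame := contextFrame hH hS
  trans p s a := if (s : ℕ) < 2 * (H - 1) then PMF.pure (chainNext H s)
    else contextTrans hH hS (q p s a)
  trans_layer p s a x hx := by
    by_cases hs : (s : ℕ) < 2 * (H - 1)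
    · rw [if_pos hs, PMF.pure_apply] at hx
      have hx' : x = chainNext H s := by
        by_contra h
        simp [h] at hx
      subst hx'
      unfold chainNext
      split_ifs with h
      · simp only [Frame.layerOf, contextFrame, dif_pos h.1, dif_pos hs]
        omega
      · simp only [Frame.layerOf, contextFrame, dif_pos hs]
        omega
    · rw [if_neg hs, contextTrans, PMF.ofFintype_apply] at hx
      have h2 : 2 * (H - 1) > 1 := by omega
      split_ifs at hx with h h
      · subst h
        simp only [Frame.layerOf, contextFrame, goodState, dif_pos h2, dif_neg hs]
      · subst h
        simp only [Frame.layerOf, contextFrame, badState, dif_neg hs]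
        rw [dif_pos (by omega)]
      · exact absurd rfl hx
  reward p s a := ⟨Measure.dirac (stateReward H s), inferInstance⟩

section Values

variable {S A H M : ℕ} (hH : 2 ≤ H) (hS : 4 * H ≤ S)
  (q : Fin M → Fin S → Fin A → unitInterval)

lemma banditEnv_meanReward (p : Fin M) (s : Fin S) (a : Fin A) :
    (banditEnv hH hS q).meanReward p s a =
      if (s : ℕ) < 2 * (H - 1) ∧ (s : ℕ) % 2 = 1 then 1 else 0 := by
  simp only [Environment.meanReward, banditEnv, ProbabilityMeasure.coe_mk, integral_dirac,
    stateReward]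
  split_ifs <;> rfl

lemma backup_of_chain (p : Fin M) (f : Fin S → ℝ) (s : Fin S) (a : Fin A)
    (hs : (s : ℕ) < 2 * (H - 1)) :
    (banditEnv hH hS q).backup p f s a =
      (if (s : ℕ) % 2 = 1 then 1 else 0) + (chainNext H s).elim 0 f := by
  rw [Environment.backup, banditEnv_meanReward]
  simp only [hs, true_and]
  congr 1
  simp only [banditEnv, hs, if_true, PMF.pure_apply]
  cases h : chainNext H s with
  | none => simp
  | some t =>
    rw [Finset.sum_eq_single t]
    · simp
    · intro b _ hb
      simp [hb]
    · simp

lemma backup_of_context (p : Fin M) (f : Fin S → ℝ) (s : Fin S) (a : Fin A)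
    (hs : s ∈ contexts S H) :
    (banditEnv hH hS q).backup p f s a =
      q p s a * f (goodState hH hS) + (1 - q p s a) * f (badState hH hS) := by
  have hs' : ¬ (s : ℕ) < 2 * (H - 1) := by simpa [contexts] using hs
  rw [Environment.backup, banditEnv_meanReward]
  simp only [hs', false_and, if_false, zero_add]
  have hne : badState hH hS ≠ goodState hH hS := by simp [badState, goodState]
  have h1 := (q p s a).2.1
  have h2 := (q p s a).2.2
  simp only [banditEnv, hs', if_false, contextTrans, PMF.ofFintype_apply]
  rw [← Finset.sum_subset (Finset.subset_univ {goodState hH hS, badState hH hS})]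
  · rw [Finset.sum_pair hne.symm]
    simp [hne, h1, h2]
  · intro x _ hx
    simp only [Finset.mem_insert, Finset.mem_singleton, not_or] at hx
    simp [hx.1, hx.2]

/-- The value of a chain state with `n` steps to go. -/
def chainValue {S : ℕ} (n : ℕ) (s : Fin S) : ℝ := if (s : ℕ) % 2 = 1 then n else 0

/-- One step of the Bellman recursion along a chain. The last state of the chain has no successor,
but there `n = 0`. -/
lemma chain_step (hS : 4 * H ≤ S) (f : Fin S → ℝ) (n : ℕ) (s : Fin S) (hs : (s : ℕ) < 2 * (H - 1))
    (hn : n + 1 + (s / 2 + 1) ≤ H)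
    (hf : ∀ t : Fin S, (t : ℕ) < 2 * (H - 1) → n + (t / 2 + 1) ≤ H → f t = chainValue n t) :
    (if (s : ℕ) % 2 = 1 then (1 : ℝ) else 0) + (chainNext H s).elim 0 f = chainValue (n + 1) s := by
  unfold chainNext
  have hsS := s.2
  split_ifs with h1 h2 h2
  · rw [Option.elim_some, hf _ h2.1 (by simp only; omega)]
    simp [chainValue, h1, add_comm]
  · have : n = 0 := by omega
    subst this
    simp [chainValue, h1]
  · rw [Option.elim_some, hf _ h2.1 (by simp only; omega)]
    simp [chainValue, h1]
  · simp [chainValue, h1]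

lemma valueToGo_of_chain (p : Fin M) (π : Policy S A) (n : ℕ) :
    ∀ s : Fin S, (s : ℕ) < 2 * (H - 1) → n + (s / 2 + 1) ≤ H →
      (banditEnv hH hS q).valueToGo p π n s = chainValue n s := by
  induction n with
  | zero => intro s _ _; simp [Environment.valueToGo, chainValue]
  | succ n ih =>
    intro s hs hn
    rw [Environment.valueToGo, backup_of_chain hH hS q p _ s _ hs]
    exact chain_step hS _ n s hs hn ih

lemma optValueToGo_of_chain [Nonempty (Fin A)] (p : Fin M) (n : ℕ) :
    ∀ s : Fin S, (s : ℕ) < 2 * (H - 1) → n + (s / 2 + 1) ≤ H →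
      (banditEnv hH hS q).optValueToGo p n s = chainValue n s := by
  induction n with
  | zero => intro s _ _; simp [Environment.optValueToGo, chainValue]
  | succ n ih =>
    intro s hs hn
    simp only [Environment.optValueToGo, backup_of_chain hH hS q p _ s _ hs, ciSup_const]
    exact chain_step hS _ n s hs hn ih

lemma layer_of_chain (s : Fin S) (hs : (s : ℕ) < 2 * (H - 1)) :
    ((banditEnv hH hS q).layer s : ℕ) = s / 2 + 1 := by
  simp [banditEnv, contextFrame, hs]

lemma layer_of_context (s : Fin S) (hs : s ∈ contexts S H) :
    ((banditEnv hH hS q).layer s : ℕ) = 0 := by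
  have hs' : ¬ (s : ℕ) < 2 * (H - 1) := by simpa [contexts] using hs
  simp [banditEnv, contextFrame, hs']

lemma value_of_context (p : Fin M) (π : Policy S A) (s : Fin S) (hs : s ∈ contexts S H) :
    (banditEnv hH hS q).value p π s = (H - 1 : ℕ) * q p s (π s) := by
  rw [Environment.value, layer_of_context hH hS q s hs]
  obtain ⟨n, rfl⟩ : ∃ n, H = n + 1 := ⟨H - 1, by omega⟩
  rw [Nat.sub_zero, Environment.valueToGo, backup_of_context hH hS q p _ s _ hs,
    valueToGo_of_chain hH hS q p π n _ (by simp only [goodState]; omega)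
      (by simp [goodState]),
    valueToGo_of_chain hH hS q p π n _ (by simp only [badState]; omega)
      (by simp [badState])]
  simp [chainValue, goodState, badState, mul_comm]

lemma optValue_of_context [Nonempty (Fin A)] (p : Fin M) (s : Fin S) (hs : s ∈ contexts S H) :
    (banditEnv hH hS q).optValue p s = ⨆ a, ((H - 1 : ℕ) * q p s a : ℝ) := by
  rw [Environment.optValue, layer_of_context hH hS q s hs]
  obtain ⟨n, rfl⟩ : ∃ n, H = n + 1 := ⟨H - 1, by omega⟩
  rw [Nat.sub_zero, Environment.optValueToGo]
  congr 1
  ext a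
  rw [backup_of_context hH hS q p _ s _ hs,
    optValueToGo_of_chain hH hS q p n _ (by simp only [goodState]; omega)
      (by simp [goodState]),
    optValueToGo_of_chain hH hS q p n _ (by simp only [badState]; omega)
      (by simp [badState])]
  simp [chainValue, goodState, badState, mul_comm]

lemma optQ_of_context [Nonempty (Fin A)] (p : Fin M) (s : Fin S) (a : Fin A)
    (hs : s ∈ contexts S H) :
    (banditEnv hH hS q).optQ p s a = (H - 1 : ℕ) * q p s a := by
  have hg : (goodState hH hS : ℕ) < 2 * (H - 1) := by simp only [goodState]; omega
  have hb : (badState hH hS : ℕ) < 2 * (H - 1) := by simp only [badState]; omega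
  rw [Environment.optQ, backup_of_context hH hS q p _ s _ hs, Environment.optValue,
    Environment.optValue, layer_of_chain hH hS q _ hg, layer_of_chain hH hS q _ hb]
  rw [optValueToGo_of_chain hH hS q p _ _ hg (by simp only [goodState]; omega),
    optValueToGo_of_chain hH hS q p _ _ hb (by simp only [badState]; omega)]
  simp [chainValue, goodState, badState, mul_comm]

lemma banditEnv_init_toReal (s : Fin S) :
    ((banditEnv hH hS q).init s).toReal =
      if s ∈ contexts S H then ((contexts S H).card : ℝ)⁻¹ else 0 := by
  simp only [banditEnv, contextFrame, PMF.uniformOfFinset_apply]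
  split_ifs <;> simp

lemma optValue_eq_of_isMax [Nonempty (Fin A)] (p : Fin M) {s : Fin S} (hs : s ∈ contexts S H)
    {v : ℝ} (hle : ∀ a, (q p s a : ℝ) ≤ v) (hv : ∃ a, (q p s a : ℝ) = v) :
    (banditEnv hH hS q).optValue p s = (H - 1 : ℕ) * v := by
  rw [optValue_of_context hH hS q p s hs]
  refine le_antisymm (ciSup_le fun a => by gcongr; exact hle a) ?_
  obtain ⟨a, rfl⟩ := hv
  exact le_ciSup (f := fun a => ((H - 1 : ℕ) * q p s a : ℝ)) (Set.finite_range _).bddAbove a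

lemma gap_eq_of_isMax [Nonempty (Fin A)] (p : Fin M) {s : Fin S} (a : Fin A)
    (hs : s ∈ contexts S H) {v : ℝ} (hle : ∀ a, (q p s a : ℝ) ≤ v) (hv : ∃ a, (q p s a : ℝ) = v) :
    (banditEnv hH hS q).gap p s a = (H - 1 : ℕ) * (v - q p s a) := by
  rw [Environment.gap, optValue_eq_of_isMax hH hS q p hs hle hv, optQ_of_context hH hS q p s a hs,
    mul_sub]

/-- The regret of a policy in one episode, if the best probability to reach the good state is `v`
in each context. -/
lemma optInitValue_sub_initValue [Nonempty (Fin A)] (p : Fin M) (π : Policy S A) {v : ℝ}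
    (hv : ∀ s ∈ contexts S H, (∀ a, (q p s a : ℝ) ≤ v) ∧ ∃ a, (q p s a : ℝ) = v) :
    (banditEnv hH hS q).optInitValue p - (banditEnv hH hS q).initValue p π =
      ∑ s ∈ contexts S H, ((contexts S H).card : ℝ)⁻¹ * ((H - 1 : ℕ) * (v - q p s (π s))) := by
  rw [Environment.optInitValue, Environment.initValue, ← Finset.sum_sub_distrib]
  simp only [banditEnv_init_toReal, ite_mul, zero_mul, Finset.sum_sub_distrib]
  simp only [Finset.sum_ite_mem, Finset.univ_inter]
  rw [← Finset.sum_sub_distrib]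
  refine Finset.sum_congr rfl fun s hs => ?_
  rw [optValue_eq_of_isMax hH hS q p hs (hv s hs).1 (hv s hs).2,
    value_of_context hH hS q p π s hs]
  ring

lemma isDissimilar_banditEnv {δ : ℝ} (hδ : 0 ≤ δ)
    (h : ∀ p p' : Fin M, ∀ s a, |(q p s a : ℝ) - q p' s a| ≤ δ) :
    (banditEnv hH hS q).IsDissimilar (2 * H * δ) := by
  have hH0 : (0 : ℝ) < H := by exact_mod_cast (by omega : 0 < H)
  refine ⟨by positivity, fun p p' s a => ⟨?_, ?_⟩⟩
  · rw [banditEnv_meanReward, banditEnv_meanReward, sub_self, abs_zero]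
    positivity
  · rw [show 2 * H * δ / H = 2 * δ by field_simp]
    by_cases hs : (s : ℕ) < 2 * (H - 1)
    · simp only [banditEnv, hs, if_true, sub_self, abs_zero, Finset.sum_const_zero]
      positivity
    · have hne : badState hH hS ≠ goodState hH hS := by simp [badState, goodState]
      have h1 := (q p s a).2.1
      have h2 := (q p s a).2.2
      have h3 := (q p' s a).2.1
      have h4 := (q p' s a).2.2
      simp only [banditEnv, hs, if_false, contextTrans, PMF.ofFintype_apply]
      rw [← Finset.sum_subset
        (Finset.subset_univ {some (goodState hH hS), some (badState hH hS)})]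
      · rw [Finset.sum_pair (by simpa using hne.symm)]
        have h5 := h p p' s a
        have h6 : |(1 - (q p s a : ℝ)) - (1 - q p' s a)| ≤ δ := by
          rw [sub_sub_sub_cancel_left, abs_sub_comm]; exact h5
        simp only [if_true, Option.some.injEq, hne, if_false]
        rw [ENNReal.toReal_ofReal h1, ENNReal.toReal_ofReal h3,
          ENNReal.toReal_ofReal (by linarith), ENNReal.toReal_ofReal (by linarith)]
        linarith
      · intro x _ hx
        simp only [Finset.mem_insert, Finset.mem_singleton, not_or] at hx
        simp [hx.1, hx.2]

end Values

/-! ### The law of the history as a finite sum of point masses -/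

/-- The visited states of all players, and the policies, in each of `k` episodes. -/
abbrev StateHistory (S A H M k : ℕ) := Fin k → JointPolicy S A M × (Fin M → Fin H → Fin S)

/-- The trajectory determined by the visited states, if the reward is a function of the state. -/
def toTrajectory {S A H : ℕ} (rew : Fin S → Set.Icc (0 : ℝ) 1) (π : Policy S A)
    (x : Fin H → Fin S) : Trajectory S A H :=
  fun h => ((x h, π (x h)), rew (x h))

/-- The history determined by policies and visited states, if the reward is a function of the
state. -/
def StateHistory.toHistory {S A H M k : ℕ} (rew : Fin S → Set.Icc (0 : ℝ) 1)
    (w : StateHistory S A H M k) : History S A H M k :=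
  fun i => ((w i).1, fun p => toTrajectory rew ((w i).1 p) ((w i).2 p))

instance (S A H M : ℕ) : MeasurableSingletonClass (Episode S A H M) :=
  inferInstanceAs (MeasurableSingletonClass (JointPolicy S A M × (Fin M → Trajectory S A H)))

instance (S A H M k : ℕ) : MeasurableSingletonClass (History S A H M k) :=
  inferInstanceAs (MeasurableSingletonClass (Fin k → Episode S A H M))

lemma pi_dirac {ι : Type*} [Fintype ι] {X : ι → Type*} [∀ i, MeasurableSpace (X i)]
    (x : ∀ i, X i) : Measure.pi (fun i => Measure.dirac (x i)) = Measure.dirac x := by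
  classical
  refine Measure.pi_eq fun s hs => ?_
  rw [Measure.dirac_apply' _ (MeasurableSet.univ_pi hs)]
  simp_rw [Measure.dirac_apply' _ (hs _), Set.indicator_apply, Pi.one_apply]
  rw [Finset.prod_ite_zero]
  simp

namespace Environment

variable {S A H M : ℕ} (I : Environment S A H M) (rew : Fin S → Set.Icc (0 : ℝ) 1)

/-- The probability of the given states in an episode with the given policies. -/
def pathWeight (π : JointPolicy S A M) (x : Fin M → Fin H → Fin S) : ℝ≥0∞ :=
  ∏ p, I.statePath p (π p) (x p)

/-- The probability of the given policies and states in the first episodes, if the reward is a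
function of the state. -/
def historyWeight (alg : Algorithm S A H M) : (k : ℕ) → StateHistory S A H M k → ℝ≥0∞
  | 0, _ => 1
  | k + 1, w => historyWeight alg k (Fin.init w) *
      (alg.next I.toFrame k (StateHistory.toHistory rew (Fin.init w)) {(w (Fin.last k)).1} *
        I.pathWeight (w (Fin.last k)).1 (w (Fin.last k)).2)

variable {rew}

lemma trajectoryLaw_eq (hrew : ∀ p s a, (I.reward p s a : Measure _) = Measure.dirac (rew s))
    (p : Fin M) (π : Policy S A) :
    I.trajectoryLaw p π = ∑ x, I.statePath p π x • Measure.dirac (toTrajectory rew π x) := by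
  unfold trajectoryLaw
  refine Finset.sum_congr rfl fun x _ => ?_
  simp_rw [hrew, Measure.dirac_prod_dirac]
  rw [pi_dirac]
  rfl

lemma runKernel_eq (hrew : ∀ p s a, (I.reward p s a : Measure _) = Measure.dirac (rew s))
    (π : JointPolicy S A M) :
    I.runKernel π = ∑ x, I.pathWeight π x •
      Measure.dirac (fun p => toTrajectory rew (π p) (x p)) := by
  have h1 : ∀ p, I.trajectoryLaw p (π p) =
      (I.statePath p (π p)).toMeasure.map (toTrajectory rew (π p)) := by
    intro p
    rw [I.trajectoryLaw_eq hrew]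
    ext s hs
    rw [Measure.map_apply (Measurable.of_discrete) hs, PMF.toMeasure_apply_fintype]
    simp only [Measure.finsetSum_apply, Measure.smul_apply, smul_eq_mul,
      Measure.dirac_apply' _ hs]
    refine Finset.sum_congr rfl fun x _ => ?_
    by_cases hx : toTrajectory rew (π p) x ∈ s
    · simp [hx]
    · simp [hx]
  have h2 : Measure.pi (fun p => (I.statePath p (π p)).toMeasure) =
      ∑ x, I.pathWeight π x • Measure.dirac x := by
    rw [← Measure.sum_smul_dirac (Measure.pi fun p => (I.statePath p (π p)).toMeasure),
      Measure.sum_fintype]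
    refine Finset.sum_congr rfl fun x _ => ?_
    rw [Measure.pi_singleton]
    simp [pathWeight]
  change Measure.pi (fun p => I.trajectoryLaw p (π p)) = _
  simp_rw [h1]
  rw [← Measure.pi_map_pi (fun p => Measurable.aemeasurable Measurable.of_discrete), h2]
  ext s hs
  rw [Measure.map_apply (Measurable.of_discrete) hs]
  simp only [Measure.finsetSum_apply, Measure.smul_apply, smul_eq_mul, Measure.dirac_apply' _ hs,
    Measure.dirac_apply' _ (MeasurableSet.of_discrete (s := _ ⁻¹' s))]
  rfl

lemma historyLaw_eq (hrew : ∀ p s a, (I.reward p s a : Measure _) = Measure.dirac (rew s))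
    (alg : Algorithm S A H M) (k : ℕ) :
    I.historyLaw alg k = ∑ w : StateHistory S A H M k, I.historyWeight rew alg k w •
      Measure.dirac (w.toHistory rew) := by
  induction k with
  | zero =>
    simp only [historyLaw, historyWeight, one_smul]
    rw [Fintype.sum_unique]
    congr 1
    exact Subsingleton.elim _ _
  | succ k ih =>
    ext s hs
    rw [historyLaw, Measure.map_apply (measurable_snoc k) hs,
      Measure.compProd_apply (measurable_snoc k hs), ih, lintegral_finsetSum_measure]
    have hs' := measurable_snoc (S := S) (A := A) (H := H) (M := M) k hs
    simp only [lintegral_smul_measure]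
    rw [← (Fin.snocEquiv fun _ => JointPolicy S A M × (Fin M → Fin H → Fin S)).sum_comp,
      Fintype.sum_prod_type_right]
    simp only [Measure.finsetSum_apply]
    refine Finset.sum_congr rfl fun w _ => ?_
    rw [lintegral_dirac, episodeKernel, Kernel.compProd_apply (measurable_prodMk_left hs'),
      lintegral_fintype, Fintype.sum_prod_type, smul_eq_mul, Finset.mul_sum]
    refine Finset.sum_congr rfl fun π _ => ?_
    rw [Kernel.prodMkLeft_apply, I.runKernel_eq hrew]
    simp only [Measure.finsetSum_apply, Finset.sum_mul, Finset.mul_sum]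
    refine Finset.sum_congr rfl fun x _ => ?_
    have h1 : StateHistory.toHistory rew
        ((Fin.snocEquiv fun _ => JointPolicy S A M × (Fin M → Fin H → Fin S)) ((π, x), w)) =
        Fin.snoc (StateHistory.toHistory rew w)
          (π, fun p => toTrajectory rew (π p) (x p)) := by
      funext i
      refine Fin.lastCases ?_ (fun j => ?_) i <;> simp [StateHistory.toHistory, Fin.snocEquiv]
    have h2 : I.historyWeight rew alg (k + 1)
        ((Fin.snocEquiv fun _ => JointPolicy S A M × (Fin M → Fin H → Fin S)) ((π, x), w)) =
        I.historyWeight rew alg k w *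
          (alg.next I.toFrame k (StateHistory.toHistory rew w) {π} * I.pathWeight π x) := by
      simp [historyWeight, Fin.snocEquiv]
    rw [h1, h2]
    simp only [Measure.smul_apply, smul_eq_mul, Measure.dirac_apply' _ hs]
    rw [Measure.dirac_apply' _ (measurable_prodMk_left (measurable_prodMk_left hs'))]
    change _ * (_ * s.indicator 1 (Fin.snoc (StateHistory.toHistory rew w)
      (π, fun p => toTrajectory rew (π p) (x p))) * _) = _
    ring

lemma sum_historyWeight (hrew : ∀ p s a, (I.reward p s a : Measure _) = Measure.dirac (rew s))
    (alg : Algorithm S A H M) (k : ℕ) : ∑ w, I.historyWeight rew alg k w = 1 := by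
  have h := measure_univ (μ := I.historyLaw alg k)
  rw [I.historyLaw_eq hrew] at h
  simpa using h

lemma expectedRegret_eq (hrew : ∀ p s a, (I.reward p s a : Measure _) = Measure.dirac (rew s))
    (alg : Algorithm S A H M) (K : ℕ) :
    I.expectedRegret alg K = ∑ w, (I.historyWeight rew alg K w).toReal *
      ∑ p, ∑ k, (I.optInitValue p - I.initValue p ((w k).1 p)) := by
  have hne : ∀ w, I.historyWeight rew alg K w ≠ ∞ := fun w => by
    have h := Finset.single_le_sum (f := I.historyWeight rew alg K) (fun _ _ => zero_le)
      (Finset.mem_univ w)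
    rw [I.sum_historyWeight hrew] at h
    exact ne_top_of_le_ne_top ENNReal.one_ne_top h
  rw [expectedRegret, I.historyLaw_eq hrew, integral_finsetSum_measure]
  · refine Finset.sum_congr rfl fun w _ => ?_
    rw [integral_smul_measure, integral_dirac]
    rfl
  · intro w _
    exact (integrable_dirac (by simp)).smul_measure (hne w)

variable (rew)

/-- The probability of the given policies and states in the first episodes, as a real number. -/
def historyProb (alg : Algorithm S A H M) (k : ℕ) (w : StateHistory S A H M k) : ℝ :=
  (I.historyWeight rew alg k w).toReal

/-- The law of the policies and states in the next episode. -/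
def episodeProb (alg : Algorithm S A H M) (k : ℕ) (w : StateHistory S A H M k)
    (y : JointPolicy S A M × (Fin M → Fin H → Fin S)) : ℝ :=
  (alg.next I.toFrame k (w.toHistory rew)).real {y.1} *
    ∏ p, (I.statePath p (y.1 p) (y.2 p)).toReal

/-- Appending an episode to a history. -/
def snocEquiv (S A H M k : ℕ) :
    StateHistory S A H M k × (JointPolicy S A M × (Fin M → Fin H → Fin S)) ≃
      StateHistory S A H M (k + 1) :=
  (Equiv.prodComm _ _).trans
    (Fin.snocEquiv fun _ => JointPolicy S A M × (Fin M → Fin H → Fin S))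

lemma historyProb_snoc (alg : Algorithm S A H M) (k : ℕ)
    (z : StateHistory S A H M k × (JointPolicy S A M × (Fin M → Fin H → Fin S))) :
    I.historyProb rew alg (k + 1) (snocEquiv S A H M k z) =
      I.historyProb rew alg k z.1 * I.episodeProb rew alg k z.1 z.2 := by
  simp [historyProb, historyWeight, snocEquiv, episodeProb, pathWeight, ENNReal.toReal_mul,
    ENNReal.toReal_prod, Measure.real, Fin.snocEquiv]

lemma sum_statePath_toReal (p : Fin M) (π : Policy S A) :
    ∑ x, (I.statePath p π x).toReal = 1 := by
  rw [← ENNReal.toReal_sum fun x _ => (I.statePath p π).apply_ne_top x,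
    ← tsum_fintype (L := .unconditional _), PMF.tsum_coe, ENNReal.toReal_one]

lemma sum_prod_statePath_toReal (π : JointPolicy S A M) :
    ∑ x : Fin M → Fin H → Fin S, ∏ p, (I.statePath p (π p) (x p)).toReal = 1 := by
  rw [← Fintype.piFinset_univ,
    ← Finset.prod_univ_sum (fun _ : Fin M => (Finset.univ : Finset (Fin H → Fin S)))
      (fun p y => (I.statePath p (π p) y).toReal)]
  simp [sum_statePath_toReal]

lemma sum_next_real (alg : Algorithm S A H M) (F : Frame S H) (k : ℕ) (h : History S A H M k) :
    ∑ π, (alg.next F k h).real {π} = 1 := by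
  simp [Measure.real, ← ENNReal.toReal_sum]

lemma sum_episodeProb_mul (alg : Algorithm S A H M) (k : ℕ) (w : StateHistory S A H M k)
    (g : JointPolicy S A M → ℝ) :
    ∑ y, I.episodeProb rew alg k w y * g y.1 =
      ∑ π, (alg.next I.toFrame k (w.toHistory rew)).real {π} * g π := by
  rw [Fintype.sum_prod_type]
  refine Finset.sum_congr rfl fun π _ => ?_
  simp only [episodeProb]
  rw [← Finset.sum_mul, ← Finset.mul_sum, sum_prod_statePath_toReal, mul_one]

lemma sum_episodeProb (alg : Algorithm S A H M) (k : ℕ) (w : StateHistory S A H M k) :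
    ∑ y, I.episodeProb rew alg k w y = 1 := by
  have h := I.sum_episodeProb_mul rew alg k w fun _ => 1
  simpa [sum_next_real] using h

variable {rew}

lemma sum_historyProb (hrew : ∀ p s a, (I.reward p s a : Measure _) = Measure.dirac (rew s))
    (alg : Algorithm S A H M) (k : ℕ) : ∑ w, I.historyProb rew alg k w = 1 := by
  have h := I.sum_historyWeight hrew alg k
  simp only [historyProb]
  rw [← ENNReal.toReal_sum, h, ENNReal.toReal_one]
  intro w hw
  exact ENNReal.lt_top_of_sum_ne_top (by rw [h]; exact ENNReal.one_ne_top) hw |>.ne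

variable (rew)

lemma historyProb_nonneg (alg : Algorithm S A H M) (k : ℕ) (w : StateHistory S A H M k) :
    0 ≤ I.historyProb rew alg k w := ENNReal.toReal_nonneg

section Divergence

variable {I} {J : Environment S A H M} (hF : I.toFrame = J.toFrame)
  (hac : ∀ p π x, (J.statePath p π x).toReal = 0 → (I.statePath p π x).toReal = 0)

include hF hac

lemma episodeProb_eq_zero (alg : Algorithm S A H M) (k : ℕ) (w : StateHistory S A H M k)
    (y : JointPolicy S A M × (Fin M → Fin H → Fin S)) (h : J.episodeProb rew alg k w y = 0) :
    I.episodeProb rew alg k w y = 0 := by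
  rw [episodeProb, mul_eq_zero, Finset.prod_eq_zero_iff] at h ⊢
  rw [hF]
  exact h.imp id fun ⟨p, hp, h⟩ => ⟨p, hp, hac _ _ _ h⟩

lemma historyProb_eq_zero (alg : Algorithm S A H M) (k : ℕ) :
    ∀ w : StateHistory S A H M k, J.historyProb rew alg k w = 0 →
      I.historyProb rew alg k w = 0 := by
  induction k with
  | zero => intro w h; simp [historyProb, historyWeight] at h
  | succ k ih =>
    intro w
    obtain ⟨z, rfl⟩ := (snocEquiv S A H M k).surjective w
    rw [historyProb_snoc, historyProb_snoc, mul_eq_zero, mul_eq_zero]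
    exact Or.imp (ih _) (episodeProb_eq_zero rew hF hac alg k _ _)

lemma relEntropy_episodeProb (alg : Algorithm S A H M) (k : ℕ) (w : StateHistory S A H M k) :
    relEntropy (I.episodeProb rew alg k w) (J.episodeProb rew alg k w) =
      ∑ y, I.episodeProb rew alg k w y *
        ∑ p, relEntropy (fun x => (I.statePath p (y.1 p) x).toReal)
          (fun x => (J.statePath p (y.1 p) x).toReal) := by
  rw [I.sum_episodeProb_mul rew alg k w fun π => ∑ p, relEntropy
    (fun x => (I.statePath p (π p) x).toReal) (fun x => (J.statePath p (π p) x).toReal)]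
  have h := relEntropy_mul (p := fun π => (alg.next I.toFrame k (w.toHistory rew)).real {π})
    (q := fun π => (alg.next I.toFrame k (w.toHistory rew)).real {π})
    (κ := fun π (x : Fin M → Fin H → Fin S) => ∏ p, (I.statePath p (π p) (x p)).toReal)
    (η := fun π (x : Fin M → Fin H → Fin S) => ∏ p, (J.statePath p (π p) (x p)).toReal)
    (fun π _ => I.sum_prod_statePath_toReal π) (fun _ => id) (fun π x h => by
      rw [Finset.prod_eq_zero_iff] at h ⊢
      exact h.imp fun p ⟨hp, h⟩ => ⟨hp, hac _ _ _ h⟩)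
  have h0 : relEntropy (fun π => (alg.next I.toFrame k (w.toHistory rew)).real {π})
      (fun π => (alg.next I.toFrame k (w.toHistory rew)).real {π}) = 0 := by
    refine Finset.sum_eq_zero fun π _ => ?_
    dsimp only
    by_cases h : (alg.next I.toFrame k (w.toHistory rew)).real {π} = 0
    · rw [h, zero_mul]
    · rw [div_self h, Real.log_one, mul_zero]
  rw [h0, zero_add] at h
  unfold episodeProb
  rw [← hF]
  refine h.trans (Finset.sum_congr rfl fun π _ => ?_)
  rw [relEntropy_pi (p := fun p x => (I.statePath p (π p) x).toReal)
    (q := fun p x => (J.statePath p (π p) x).toReal)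
    (fun p => I.sum_statePath_toReal p (π p)) fun p x => hac p (π p) x]

/-- Divergence decomposition: the relative entropy of the laws of the history under two
environments is the expectation, under the first of them, of the sum over all episodes and players
of the relative entropies of the laws of the visited states. -/
lemma relEntropy_historyProb (alg : Algorithm S A H M) (k : ℕ) :
    relEntropy (I.historyProb rew alg k) (J.historyProb rew alg k) =
      ∑ w, I.historyProb rew alg k w * ∑ i, ∑ p,
        relEntropy (fun x => (I.statePath p ((w i).1 p) x).toReal)
          (fun x => (J.statePath p ((w i).1 p) x).toReal) := by
  induction k with
  | zero => simp [relEntropy, historyProb, historyWeight]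
  | succ k ih =>
    have h1 : relEntropy (I.historyProb rew alg (k + 1)) (J.historyProb rew alg (k + 1)) =
        relEntropy (fun z : StateHistory S A H M k ×
            (JointPolicy S A M × (Fin M → Fin H → Fin S)) =>
            I.historyProb rew alg k z.1 * I.episodeProb rew alg k z.1 z.2)
          (fun z => J.historyProb rew alg k z.1 * J.episodeProb rew alg k z.1 z.2) := by
      simp only [relEntropy, ← historyProb_snoc]
      rw [← (snocEquiv S A H M k).sum_comp]
    rw [h1, relEntropy_mul (fun w _ => I.sum_episodeProb rew alg k w)
      (historyProb_eq_zero rew hF hac alg k) (episodeProb_eq_zero rew hF hac alg k), ih,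
      ← (snocEquiv S A H M k).sum_comp]
    simp_rw [historyProb_snoc, relEntropy_episodeProb rew hF hac]
    rw [Fintype.sum_prod_type, ← Finset.sum_add_distrib]
    refine Finset.sum_congr rfl fun w _ => ?_
    simp_rw [Fin.sum_univ_castSucc, mul_assoc, ← Finset.mul_sum]
    rw [← mul_add]
    congr 1
    simp only [snocEquiv, Fin.snocEquiv, Equiv.trans_apply, Equiv.prodComm_apply, Equiv.coe_fn_mk,
      Prod.swap, Fin.snoc_castSucc, Fin.snoc_last]
    simp_rw [mul_add]
    rw [Finset.sum_add_distrib, ← Finset.sum_mul, sum_episodeProb, one_mul]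

end Divergence

end Environment

/-! ### The divergence of two bandit environments -/

lemma pathMass_eq_zero {S : ℕ} {T T' : Fin S → PMF (Option (Fin S))}
    (hT : ∀ s x, T' s x = 0 → T s x = 0) (l : List (Fin S)) :
    ∀ d d' : PMF (Option (Fin S)), (∀ x, d' x = 0 → d x = 0) →
      pathMass T' d' l = 0 → pathMass T d l = 0 := by
  induction l with
  | nil => intro d d' hd h; exact hd _ h
  | cons s t ih =>
    intro d d' hd h
    rw [pathMass, mul_eq_zero] at h ⊢
    exact h.imp (hd _) (ih _ _ (hT s))

/-- Chains that differ only in the transitions out of the first layer agree from the second layer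
on. -/
lemma pathMass_congr {S H : ℕ} (F : Frame S H) {T T' : Fin S → PMF (Option (Fin S))}
    (hT : ∀ s x, T s x ≠ 0 → F.layerOf x = (F.layer s : ℕ) + 1)
    (h : ∀ s, (F.layer s : ℕ) ≠ 0 → T s = T' s) (l : List (Fin S)) :
    ∀ s, (F.layer s : ℕ) ≠ 0 → pathMass T (T s) l = pathMass T' (T' s) l := by
  induction l with
  | nil => intro s hs; rw [h s hs]; rfl
  | cons t l ih =>
    intro s hs
    rw [pathMass, pathMass, ← h s hs]
    by_cases h0 : T s (some t) = 0
    · rw [h0, zero_mul, zero_mul]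
    · have h1 : (F.layer t : ℕ) = F.layer s + 1 := hT s _ h0
      rw [ih t (by omega)]

section

variable {S A H M : ℕ} (hH : 2 ≤ H) (hS : 4 * H ≤ S)

lemma banditEnv_reward (q : Fin M → Fin S → Fin A → unitInterval) (p : Fin M) (s : Fin S)
    (a : Fin A) :
    ((banditEnv hH hS q).reward p s a : Measure (Set.Icc (0 : ℝ) 1)) =
      Measure.dirac (stateReward H s) := rfl

/-- The relative entropy of the laws of the transitions out of the first layer. -/
lemma relEntropy_first_transition (q q' : Fin M → Fin S → Fin A → unitInterval) (p : Fin M)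
    (π : Policy S A) :
    relEntropy (fun z : Fin S × Fin S => ((banditEnv hH hS q).init z.1).toReal *
        ((banditEnv hH hS q).trans p z.1 (π z.1) (some z.2)).toReal)
      (fun z => ((banditEnv hH hS q).init z.1).toReal *
        ((banditEnv hH hS q').trans p z.1 (π z.1) (some z.2)).toReal) =
      ∑ s ∈ contexts S H, ((contexts S H).card : ℝ)⁻¹ *
        coinEntropy (q p s (π s)) (q' p s (π s)) := by
  have hc : ((contexts S H).card : ℝ)⁻¹ ≠ 0 := by
    have := Finset.card_pos.2 (contexts_nonempty hH hS)
    positivity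
  have hne : badState hH hS ≠ goodState hH hS := by simp [badState, goodState]
  simp only [relEntropy]
  rw [Fintype.sum_prod_type, ← Finset.sum_subset (Finset.subset_univ (contexts S H))]
  · refine Finset.sum_congr rfl fun s hs => ?_
    have hs' : ¬ (s : ℕ) < 2 * (H - 1) := by simpa [contexts] using hs
    have h1 := (q p s (π s)).2.1
    have h2 := (q p s (π s)).2.2
    have h3 := (q' p s (π s)).2.1
    have h4 := (q' p s (π s)).2.2
    simp only [banditEnv_init_toReal, hs, if_true]
    simp only [mul_div_mul_left _ _ hc, mul_assoc]
    rw [← Finset.mul_sum]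
    congr 1
    simp only [banditEnv, hs', if_false, contextTrans, PMF.ofFintype_apply]
    rw [← Finset.sum_subset (Finset.subset_univ {goodState hH hS, badState hH hS})]
    · rw [Finset.sum_pair hne.symm]
      simp [hne, h1, h2, h3, h4, coinEntropy]
    · intro x _ hx
      simp only [Finset.mem_insert, Finset.mem_singleton, not_or] at hx
      simp [hx.1, hx.2]
  · intro s _ hs
    simp [banditEnv_init_toReal, hs]

variable {q q' : Fin M → Fin S → Fin A → unitInterval}
  (hq : ∀ p s a, ((q' p s a : ℝ) = 0 → (q p s a : ℝ) = 0) ∧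
    ((q' p s a : ℝ) = 1 → (q p s a : ℝ) = 1))

include hq

lemma banditEnv_trans_eq_zero (p : Fin M) (s : Fin S) (a : Fin A) (x : Option (Fin S))
    (h : (banditEnv hH hS q').trans p s a x = 0) : (banditEnv hH hS q).trans p s a x = 0 := by
  by_cases hs : (s : ℕ) < 2 * (H - 1)
  · simpa only [banditEnv, hs, if_true] using h
  · simp only [banditEnv, hs, if_false, contextTrans, PMF.ofFintype_apply] at h ⊢
    have h1 := (q' p s a).2
    have h2 := hq p s a
    split_ifs at h ⊢
    · rw [ENNReal.ofReal_eq_zero] at h ⊢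
      exact (h2.1 (le_antisymm h h1.1)).le
    · rw [ENNReal.ofReal_eq_zero] at h ⊢
      have := h2.2 (le_antisymm h1.2 (by linarith))
      linarith
    · rfl

lemma banditEnv_statePath_eq_zero (p : Fin M) (π : Policy S A) (x : Fin H → Fin S)
    (h : ((banditEnv hH hS q').statePath p π x).toReal = 0) :
    ((banditEnv hH hS q).statePath p π x).toReal = 0 := by
  rw [ENNReal.toReal_eq_zero_iff, or_iff_left (PMF.apply_ne_top _ _)] at h ⊢
  exact pathMass_eq_zero (fun s x => banditEnv_trans_eq_zero hH hS hq p s (π s) x) _ _ _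
    (fun _ => id) h

lemma relEntropy_statePath (p : Fin M) (π : Policy S A) :
    relEntropy (fun x => ((banditEnv hH hS q).statePath p π x).toReal)
      (fun x => ((banditEnv hH hS q').statePath p π x).toReal) =
      ∑ s ∈ contexts S H, ((contexts S H).card : ℝ)⁻¹ *
        coinEntropy (q p s (π s)) (q' p s (π s)) := by
  obtain ⟨n, rfl⟩ : ∃ n, H = n + 2 := ⟨H - 2, by omega⟩
  rw [← relEntropy_first_transition hH hS q q']
  set I := banditEnv hH hS q with hI
  set J := banditEnv hH hS q' with hJ
  set T : Fin S → PMF (Option (Fin S)) := fun s => I.trans p s (π s) with hT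
  set T' : Fin S → PMF (Option (Fin S)) := fun s => J.trans p s (π s) with hT'
  have hTl : ∀ s x, T s x ≠ 0 → I.layerOf x = (I.layer s : ℕ) + 1 :=
    fun s x => I.trans_layer p s (π s) x
  have hTT : ∀ s x, T' s x = 0 → T s x = 0 :=
    fun s x => banditEnv_trans_eq_zero hH hS hq p s (π s) x
  have hagree : ∀ s, (I.layer s : ℕ) ≠ 0 → T s = T' s := by
    intro s hs
    have hs' : (s : ℕ) < 2 * (n + 2 - 1) := by
      by_contra h
      exact hs (layer_of_context hH hS q s (by simpa [contexts] using h))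
    simp only [hT, hT', hI, hJ, banditEnv, hs', if_true]
  have hinit : ∀ s, (I.init.map some : PMF (Option (Fin S))) (some s) = I.init s := by
    intro s
    rw [PMF.map_apply, tsum_eq_single s]
    · simp
    · intro b hb
      simp [hb.symm]
  have hlayer : ∀ s t : Fin S, (I.init s).toReal * (T s (some t)).toReal ≠ 0 →
      (I.layer t : ℕ) = 1 := by
    intro s t h
    rw [mul_ne_zero_iff] at h
    have h1 := I.init_layer s fun h' => h.1 (by rw [h', ENNReal.toReal_zero])
    have h2 : (I.layer t : ℕ) = I.layer s + 1 :=
      hTl s (some t) fun h' => h.2 (by rw [h', ENNReal.toReal_zero])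
    omega
  let e : (Fin S × Fin S) × (Fin n → Fin S) ≃ (Fin (n + 2) → Fin S) :=
    (Equiv.prodAssoc _ _ _).trans
      (((Equiv.refl _).prodCongr (Fin.consEquiv fun _ => Fin S)).trans
        (Fin.consEquiv fun _ => Fin S))
  have hI' : ∀ z, (I.statePath p π (e z)).toReal = (I.init z.1.1).toReal *
      (T z.1.1 (some z.1.2)).toReal * (pathMass T (T z.1.2) (List.ofFn z.2)).toReal := by
    intro z
    change (pathMass T (I.init.map some)
      (List.ofFn (Fin.cons z.1.1 (Fin.cons z.1.2 z.2 : Fin (n + 1) → Fin S) :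
        Fin (n + 2) → Fin S))).toReal = _
    rw [List.ofFn_cons, List.ofFn_cons, pathMass, pathMass, hinit, ENNReal.toReal_mul,
      ENNReal.toReal_mul, mul_assoc]
  have hJ' : ∀ z, (J.statePath p π (e z)).toReal = (I.init z.1.1).toReal *
      (T' z.1.1 (some z.1.2)).toReal * (pathMass T' (T' z.1.2) (List.ofFn z.2)).toReal := by
    intro z
    change (pathMass T' (I.init.map some)
      (List.ofFn (Fin.cons z.1.1 (Fin.cons z.1.2 z.2 : Fin (n + 1) → Fin S) :
        Fin (n + 2) → Fin S))).toReal = _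
    rw [List.ofFn_cons, List.ofFn_cons, pathMass, pathMass, hinit, ENNReal.toReal_mul,
      ENNReal.toReal_mul, mul_assoc]
  have hsum : ∀ t : Fin S, (I.layer t : ℕ) = 1 →
      ∑ x : Fin n → Fin S, pathMass T (T t) (List.ofFn x) = 1 := by
    intro t ht
    refine I.sum_pathMass T hTl n _ fun x hx => ?_
    rw [hTl t x hx, ht]
    omega
  have hreal : ∀ d d' : ℝ≥0∞, (d' = 0 → d = 0) → d' ≠ ∞ → d'.toReal = 0 → d.toReal = 0 := by
    intro d d' h h1 h2
    rw [ENNReal.toReal_eq_zero_iff, or_iff_left h1] at h2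
    rw [h h2, ENNReal.toReal_zero]
  have hfin : ∀ (U : Fin S → PMF (Option (Fin S))) (l : List (Fin S)) (d : PMF (Option (Fin S))),
      pathMass U d l ≠ ∞ := by
    intro U l
    induction l with
    | nil => intro d; exact d.apply_ne_top _
    | cons s t ih => intro d; exact ENNReal.mul_ne_top (d.apply_ne_top _) (ih _)
  have key := relEntropy_mul
    (p := fun z : Fin S × Fin S => (I.init z.1).toReal * (T z.1 (some z.2)).toReal)
    (q := fun z => (I.init z.1).toReal * (T' z.1 (some z.2)).toReal)
    (κ := fun z (x : Fin n → Fin S) => (pathMass T (T z.2) (List.ofFn x)).toReal)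
    (η := fun z (x : Fin n → Fin S) => (pathMass T' (T' z.2) (List.ofFn x)).toReal)
    (fun z hz => by
      rw [← ENNReal.toReal_sum fun x _ => hfin _ _ _, hsum _ (hlayer _ _ hz),
        ENNReal.toReal_one])
    (fun z hz => by
      rw [mul_eq_zero] at hz ⊢
      exact hz.imp id (hreal _ _ (hTT _ _) (PMF.apply_ne_top _ _)))
    (fun z x => hreal _ _ (pathMass_eq_zero hTT _ _ _ (hTT _)) (hfin _ _ _))
  have h1 : relEntropy (fun x => (I.statePath p π x).toReal)
      (fun x => (J.statePath p π x).toReal) =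
      relEntropy (fun z => (I.statePath p π (e z)).toReal)
        (fun z => (J.statePath p π (e z)).toReal) := by
    simp only [relEntropy]
    rw [← e.sum_comp]
  rw [h1]
  simp only [hI', hJ']
  rw [key, add_eq_left]
  refine Finset.sum_eq_zero fun z _ => ?_
  by_cases hz : (I.init z.1).toReal * (T z.1 (some z.2)).toReal = 0
  · rw [hz, zero_mul]
  · rw [mul_eq_zero]
    right
    refine Finset.sum_eq_zero fun x _ => ?_
    have h2 : (I.layer z.2 : ℕ) ≠ 0 := by rw [hlayer _ _ hz]; exact one_ne_zero
    dsimp only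
    rw [pathMass_congr I.toFrame hTl hagree _ _ h2]
    by_cases h3 : (pathMass T' (T' z.2) (List.ofFn x)).toReal = 0
    · rw [h3, zero_mul]
    · rw [div_self h3, Real.log_one, mul_zero]

/-- Under two bandit environments, the probabilities of an event that depends on policies and
visited states only differ by at most the root of the divergence of the environments. -/
lemma banditEnv_sum_le (alg : Algorithm S A H M) (K : ℕ) (E : Finset (StateHistory S A H M K)) :
    ∑ w ∈ E, (banditEnv hH hS q').historyProb (stateReward H) alg K w ≤
      ∑ w ∈ E, (banditEnv hH hS q).historyProb (stateReward H) alg K w +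
      √(∑ w, (banditEnv hH hS q).historyProb (stateReward H) alg K w * ∑ i, ∑ p,
        ∑ s ∈ contexts S H, ((contexts S H).card : ℝ)⁻¹ *
          coinEntropy (q p s ((w i).1 p s)) (q' p s ((w i).1 p s))) := by
  have h := Environment.relEntropy_historyProb (I := banditEnv hH hS q) (J := banditEnv hH hS q')
    (stateReward H) rfl (banditEnv_statePath_eq_zero hH hS hq) alg K
  simp only [relEntropy_statePath hH hS hq] at h
  rw [← h]
  exact sum_le_sum_add_sqrt_relEntropy
    (Environment.historyProb_nonneg _ _ alg K) (Environment.historyProb_nonneg _ _ alg K)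
    (Environment.sum_historyProb _ (banditEnv_reward hH hS q) alg K)
    (Environment.sum_historyProb _ (banditEnv_reward hH hS q') alg K)
    (Environment.historyProb_eq_zero (I := banditEnv hH hS q) (J := banditEnv hH hS q')
      _ rfl (banditEnv_statePath_eq_zero hH hS hq) alg K) E

end

/-! ### Hidden arms -/

section HiddenArms

variable {S A H M K m : ℕ} {Δ : ℝ}

/-- The probability of reaching the good state when each context `s` has, for each class `c` of
players, the hidden best action `θ (c, s)`. It is `0` for the actions `m, m + 1, …`, which are known
to be bad, and `1 / 2` for the other actions, except that it is `1 / 2 + Δ` for the hidden one.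
There is no best action where `θ` takes the value `m`. -/
def armMean (m : ℕ) (Δ : ℝ) (cls : Fin M → Fin M) (θ : Fin M × Fin S → ℕ) (p : Fin M)
    (s : Fin S) (a : Fin A) : ℝ :=
  if m ≤ (a : ℕ) then 0 else if (a : ℕ) = θ (cls p, s) then 1 / 2 + Δ else 1 / 2

lemma armMean_mem (hΔ : 0 ≤ Δ) (hΔ' : Δ ≤ 1 / 4) (cls : Fin M → Fin M) (θ : Fin M × Fin S → ℕ)
    (p : Fin M) (s : Fin S) (a : Fin A) : armMean m Δ cls θ p s a ∈ unitInterval := by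
  unfold armMean
  split_ifs <;> constructor <;> linarith

/-- The environment with hidden best actions `θ`. -/
def armEnv (hH : 2 ≤ H) (hS : 4 * H ≤ S) (m : ℕ) (hΔ : 0 ≤ Δ) (hΔ' : Δ ≤ 1 / 4)
    (cls : Fin M → Fin M) (θ : Fin M × Fin S → ℕ) : Environment S A H M :=
  banditEnv hH hS fun p s a => ⟨armMean m Δ cls θ p s a, armMean_mem hΔ hΔ' cls θ p s a⟩

variable (hH : 2 ≤ H) (hS : 4 * H ≤ S) (hΔ : 0 ≤ Δ) (hΔ' : Δ ≤ 1 / 4) (cls : Fin M → Fin M)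

lemma armMean_isMax (hΔ : 0 ≤ Δ) (hmA : m ≤ A) (cls : Fin M → Fin M)
    (θ : Fin M × Fin S → Fin m) (p : Fin M) :
    ∀ s ∈ contexts S H, (∀ a : Fin A, armMean m Δ cls (fun g => θ g) p s a ≤ 1 / 2 + Δ) ∧
      ∃ a : Fin A, armMean m Δ cls (fun g => θ g) p s a = 1 / 2 + Δ := by
  refine fun s _ => ⟨fun a => ?_, Fin.castLE hmA (θ (cls p, s)), ?_⟩
  · unfold armMean
    split_ifs <;> linarith
  · simp [armMean]

/-- The probability of an event in terms of policies and visited states. -/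
def armProb (m : ℕ) (alg : Algorithm S A H M) (K : ℕ) (θ : Fin M × Fin S → ℕ)
    (E : StateHistory S A H M K → Prop) : ℝ :=
  open Classical in
  ∑ w with E w, (armEnv hH hS m hΔ hΔ' cls θ).historyProb (stateReward H) alg K w

lemma sum_armProb_le_one {ι : Type*} [Fintype ι] (alg : Algorithm S A H M)
    (θ : Fin M × Fin S → ℕ) (E : ι → StateHistory S A H M K → Prop)
    (hE : ∀ w a b, E a w → E b w → a = b) :
    ∑ a, armProb hH hS hΔ hΔ' cls m alg K θ (E a) ≤ 1 := by
  classical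
  rw [← Environment.sum_historyProb (armEnv hH hS m hΔ hΔ' cls θ)
    (banditEnv_reward hH hS _) alg K]
  simp only [armProb, Finset.sum_filter]
  rw [Finset.sum_comm]
  refine Finset.sum_le_sum fun w _ => ?_
  by_cases h : ∃ a, E a w
  · obtain ⟨a, ha⟩ := h
    rw [Finset.sum_eq_single a]
    · simp [ha]
    · intro b _ hb
      rw [if_neg fun h => hb (hE w b a h ha)]
    · simp
  · push Not at h
    simp only [h, if_false, Finset.sum_const_zero]
    exact Environment.historyProb_nonneg _ _ _ _ _

lemma armProb_nonneg (alg : Algorithm S A H M)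
    (θ : Fin M × Fin S → ℕ) (E : StateHistory S A H M K → Prop) :
    0 ≤ armProb hH hS hΔ hΔ' cls m alg K θ E :=
  Finset.sum_nonneg fun _ _ => Environment.historyProb_nonneg _ _ _ _ _

/-- Making `a` the best action of context `s` for the players of class `c` is noticed only through
the choices of `a` by these players in this context. -/
lemma armProb_update_le (alg : Algorithm S A H M) (θ : Fin M × Fin S → ℕ) (c : Fin M) {s : Fin S}
    (hs : s ∈ contexts S H) (a : Fin A)
    (E : StateHistory S A H M K → Prop) :
    armProb hH hS hΔ hΔ' cls m alg K (Function.update θ (c, s) a) E ≤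
      armProb hH hS hΔ hΔ' cls m alg K (Function.update θ (c, s) m) E +
      √(4 * Δ ^ 2 / (contexts S H).card * ∑ i, ∑ p with cls p = c,
        armProb hH hS hΔ hΔ' cls m alg K (Function.update θ (c, s) m)
          fun w => (w i).1 p s = a) := by
  classical
  have hc : 0 < ((contexts S H).card : ℝ) := by
    exact_mod_cast Finset.card_pos.2 (contexts_nonempty hH hS)
  have h := banditEnv_sum_le hH hS
    (q := fun p t b => ⟨armMean m Δ cls (Function.update θ (c, s) m) p t b,
      armMean_mem hΔ hΔ' cls _ p t b⟩)
    (q' := fun p t b => ⟨armMean m Δ cls (Function.update θ (c, s) a) p t b,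
      armMean_mem hΔ hΔ' cls _ p t b⟩)
    (fun p t b => ⟨fun h => by
      simp only [armMean] at h ⊢
      split_ifs at h with h1 <;> first | (exfalso; linarith) | simp [h1], fun h => by
      simp only [armMean] at h
      split_ifs at h <;> exfalso <;> linarith⟩) alg K {w | E w}
  refine h.trans (add_le_add le_rfl (Real.sqrt_le_sqrt ?_))
  have hent : ∀ p t (b : Fin A), coinEntropy (armMean m Δ cls (Function.update θ (c, s) m) p t b)
      (armMean m Δ cls (Function.update θ (c, s) a) p t b) ≤
      if cls p = c then if t = s then if b = a then 4 * Δ ^ 2 else 0 else 0 else 0 := by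
    intro p t b
    unfold armMean
    by_cases hb : m ≤ (b : ℕ)
    · simp only [hb, if_true, coinEntropy_self]
      split_ifs <;> positivity
    by_cases hg : (cls p, t) = (c, s)
    · obtain ⟨h1, h2⟩ := Prod.mk.inj hg
      have h3 : (b : ℕ) ≠ m := by omega
      simp only [h1, h2, Function.update_self, hb, h3, if_true, if_false, Fin.val_inj]
      split_ifs
      · exact coinEntropy_half_le hΔ hΔ'
      · exact (coinEntropy_self _).le
    · simp only [Function.update_of_ne hg, coinEntropy_self]
      split_ifs <;> positivity
  have hpt : ∀ w : StateHistory S A H M K, ∑ i, ∑ p, ∑ t ∈ contexts S H,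
      ((contexts S H).card : ℝ)⁻¹ *
        coinEntropy (armMean m Δ cls (Function.update θ (c, s) m) p t ((w i).1 p t))
          (armMean m Δ cls (Function.update θ (c, s) a) p t ((w i).1 p t)) ≤
      4 * Δ ^ 2 / (contexts S H).card * ∑ i, ∑ p with cls p = c,
        if (w i).1 p s = a then 1 else 0 := by
    intro w
    rw [Finset.mul_sum]
    refine Finset.sum_le_sum fun i _ => ?_
    rw [Finset.sum_filter, Finset.mul_sum]
    refine Finset.sum_le_sum fun p _ => ?_
    calc _ ≤ ∑ t ∈ contexts S H, ((contexts S H).card : ℝ)⁻¹ * (if cls p = c then if t = s then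
          if (w i).1 p t = a then 4 * Δ ^ 2 else 0 else 0 else 0) :=
          Finset.sum_le_sum fun t _ => mul_le_mul_of_nonneg_left (hent _ _ _) (by positivity)
      _ = _ := by
        rw [Finset.sum_eq_single_of_mem s hs fun t _ ht => by simp [ht]]
        split_ifs <;> simp_all; ring
  calc _ ≤ ∑ w, (armEnv hH hS m hΔ hΔ' cls (Function.update θ (c, s) m)).historyProb
        (stateReward H) alg K w * (4 * Δ ^ 2 / (contexts S H).card * ∑ i, ∑ p with cls p = c,
          if (w i).1 p s = a then 1 else 0) :=
        Finset.sum_le_sum fun w _ => mul_le_mul_of_nonneg_left (hpt w)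
          (Environment.historyProb_nonneg _ _ _ _ _)
    _ = _ := by
      have hA : ∀ (i : Fin K) (p : Fin M),
          armProb hH hS hΔ hΔ' cls m alg K (Function.update θ (c, s) m)
            (fun w => (w i).1 p s = a) =
          ∑ w, (armEnv hH hS m hΔ hΔ' cls (Function.update θ (c, s) m)).historyProb
            (stateReward H) alg K w * if (w i).1 p s = a then 1 else 0 := by
        intro i p
        rw [armProb, Finset.sum_filter]
        refine Finset.sum_congr rfl fun w _ => ?_
        split_ifs <;> simp
      simp only [hA, Finset.mul_sum]
      rw [Finset.sum_comm]
      refine Finset.sum_congr rfl fun i _ => ?_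
      rw [Finset.sum_comm]
      exact Finset.sum_congr rfl fun p _ => Finset.sum_congr rfl fun w _ => mul_left_comm _ _ _

/-- On average over the best action in a context, no algorithm is likely to choose it. -/
lemma sum_armProb_update_le (hm : 2 ≤ m) (hmA : m ≤ A) {B : ℕ}
    (hB : ∀ c, (Finset.univ.filter fun p => cls p = c).card ≤ B)
    (hΔK : 64 * Δ ^ 2 * (K * B) ≤ (contexts S H).card * m)
    (alg : Algorithm S A H M) (θ : Fin M × Fin S → ℕ) (p : Fin M) (i : Fin K) {s : Fin S}
    (hs : s ∈ contexts S H) :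
    ∑ a : Fin m, armProb hH hS hΔ hΔ' cls m alg K (Function.update θ (cls p, s) (a : ℕ))
      (fun w => (((w i).1 p s : Fin A) : ℕ) = a) ≤ 3 / 4 * m := by
  have hc : 0 < ((contexts S H).card : ℝ) := by
    exact_mod_cast Finset.card_pos.2 (contexts_nonempty hH hS)
  have hm' : (2 : ℝ) ≤ m := by exact_mod_cast hm
  set N : ℝ := ((contexts S H).card : ℝ) with hN
  set P := armProb hH hS hΔ hΔ' cls m alg K (Function.update θ (cls p, s) m) with hP
  set x : Fin m → ℝ := fun a => ∑ i, ∑ p' with cls p' = cls p, P fun w =>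
    (w i).1 p' s = Fin.castLE hmA a with hx
  have hx0 : ∀ a, 0 ≤ x a := fun a => Finset.sum_nonneg fun _ _ => Finset.sum_nonneg fun _ _ =>
    armProb_nonneg _ _ _ _ _ _ _ _
  have hxs : ∑ a, x a ≤ K * B := by
    rw [hx, Finset.sum_comm]
    have h1 : ∀ i : Fin K, ∑ a : Fin m, ∑ p' with cls p' = cls p,
        P (fun w => (w i).1 p' s = Fin.castLE hmA a) ≤ B := by
      intro i
      rw [Finset.sum_comm]
      calc _ ≤ ∑ p' with cls p' = cls p, (1 : ℝ) := Finset.sum_le_sum fun p' _ =>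
            sum_armProb_le_one hH hS hΔ hΔ' cls alg _ _ fun w a b h h' =>
              Fin.castLE_injective hmA (h.symm.trans h')
        _ ≤ B := by
          rw [Finset.sum_const, nsmul_eq_mul, mul_one]
          exact_mod_cast hB _
    calc _ ≤ ∑ i : Fin K, (B : ℝ) := Finset.sum_le_sum fun i _ => h1 i
      _ = K * B := by simp
  have h1 : ∑ a : Fin m, P (fun w => (((w i).1 p s : Fin A) : ℕ) = a) ≤ 1 :=
    sum_armProb_le_one hH hS hΔ hΔ' cls alg _ _ fun w a b h h' => Fin.ext (h.symm.trans h')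
  -- Jensen's inequality for the square root, in the form of the Cauchy-Schwarz inequality.
  have h2 : ∑ a, √(4 * Δ ^ 2 / N * x a) ≤ m / 4 := by
    have h3 := Finset.sum_mul_sq_le_sq_mul_sq Finset.univ (fun _ : Fin m => (1 : ℝ))
      (fun a => √(4 * Δ ^ 2 / N * x a))
    have h4 : ∀ a, √(4 * Δ ^ 2 / N * x a) ^ 2 = 4 * Δ ^ 2 / N * x a := fun a =>
      Real.sq_sqrt (mul_nonneg (by positivity) (hx0 a))
    simp only [one_mul, h4, one_pow, Finset.sum_const, Finset.card_univ, Fintype.card_fin,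
      nsmul_eq_mul, mul_one, ← Finset.mul_sum] at h3
    refine abs_le_of_sq_le_sq' (h3.trans ?_) (by positivity) |>.2
    have h5 : 4 * Δ ^ 2 / N * ∑ a, x a ≤ m / 16 := by
      rw [div_mul_eq_mul_div, div_le_iff₀ hc]
      nlinarith [mul_le_mul_of_nonneg_left hxs (by positivity : 0 ≤ 4 * Δ ^ 2)]
    nlinarith
  calc _ ≤ ∑ a : Fin m, (P (fun w => (((w i).1 p s : Fin A) : ℕ) = a) +
        √(4 * Δ ^ 2 / N * x a)) := Finset.sum_le_sum fun a _ =>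
          armProb_update_le hH hS hΔ hΔ' cls alg θ (cls p) hs (Fin.castLE hmA a) _
    _ ≤ 1 + m / 4 := by
      rw [Finset.sum_add_distrib]
      exact add_le_add h1 h2
    _ ≤ _ := by linarith

lemma expectedRegret_armEnv_ge (hm : 2 ≤ m) (hmA : m ≤ A) (alg : Algorithm S A H M)
    (θ : Fin M × Fin S → Fin m) :
    ∑ p : Fin M, ∑ i : Fin K, ∑ s ∈ contexts S H, ((contexts S H).card : ℝ)⁻¹ *
      ((H - 1 : ℕ) * (Δ * (1 - armProb hH hS hΔ hΔ' cls m alg K (fun g => θ g)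
        fun w => (((w i).1 p s : Fin A) : ℕ) = θ (cls p, s)))) ≤
      (armEnv hH hS m hΔ hΔ' cls fun g => θ g).expectedRegret alg K := by
  classical
  have : Nonempty (Fin A) := ⟨⟨0, by omega⟩⟩
  set P := (armEnv hH hS m hΔ hΔ' cls fun g => θ g).historyProb (stateReward H) alg K with hP
  have hP1 : ∑ w, P w = 1 := Environment.sum_historyProb _ (banditEnv_reward hH hS _) alg K
  have hP0 : ∀ w, 0 ≤ P w := Environment.historyProb_nonneg _ _ alg K
  rw [Environment.expectedRegret_eq (armEnv hH hS m hΔ hΔ' cls fun g => θ g)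
    (banditEnv_reward hH hS _)]
  change _ ≤ ∑ w, P w * _
  have hcompl : ∀ (p : Fin M) (i : Fin K) (s : Fin S),
      1 - armProb hH hS hΔ hΔ' cls m alg K (fun g => θ g)
        (fun w => (((w i).1 p s : Fin A) : ℕ) = θ (cls p, s)) =
      ∑ w, P w * if (((w i).1 p s : Fin A) : ℕ) = θ (cls p, s) then 0 else 1 := by
    intro p i s
    conv_lhs => rw [armProb, Finset.sum_filter, ← hP1, ← Finset.sum_sub_distrib]
    refine Finset.sum_congr rfl fun w _ => ?_
    split_ifs <;> simp [hP]
  simp_rw [hcompl, Finset.mul_sum]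
  calc _ = ∑ w, ∑ p, ∑ i, ∑ s ∈ contexts S H, ((contexts S H).card : ℝ)⁻¹ *
        ((H - 1 : ℕ) * (Δ * (P w * if (((w i).1 p s : Fin A) : ℕ) = θ (cls p, s) then 0
          else 1))) := by
        exact Eq.trans (Finset.sum_congr rfl fun p _ => Eq.trans
          (Finset.sum_congr rfl fun i _ => Finset.sum_comm) Finset.sum_comm) Finset.sum_comm
    _ ≤ _ := by
      refine Finset.sum_le_sum fun w _ => Finset.sum_le_sum fun p _ =>
        Finset.sum_le_sum fun i _ => ?_
      rw [armEnv, optInitValue_sub_initValue hH hS _ p _ (armMean_isMax hΔ hmA cls θ p),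
        Finset.mul_sum]
      refine Finset.sum_le_sum fun s _ => ?_
      rw [mul_left_comm (P w)]
      refine mul_le_mul_of_nonneg_left ?_ (by positivity)
      rw [mul_left_comm (P w), mul_left_comm Δ]
      refine mul_le_mul_of_nonneg_left (mul_le_mul_of_nonneg_left ?_ (hP0 w)) (by positivity)
      simp only [armMean]
      split_ifs <;> linarith

/-- For every algorithm there are hidden best actions that make it fail in a quarter of all
episodes. -/
lemma exists_expectedRegret_ge (hm : 2 ≤ m) (hmA : m ≤ A) {B : ℕ}
    (hB : ∀ c, (Finset.univ.filter fun p => cls p = c).card ≤ B)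
    (hΔK : 64 * Δ ^ 2 * (K * B) ≤ (contexts S H).card * m) (alg : Algorithm S A H M) :
    ∃ θ : Fin M × Fin S → Fin m, (H - 1 : ℕ) * Δ * M * K / 4 ≤
      (armEnv hH hS m hΔ hΔ' cls fun g => θ g).expectedRegret alg K := by
  have hm0 : (0 : ℝ) < m := by exact_mod_cast (by omega : 0 < m)
  have : Nonempty (Fin m) := ⟨⟨0, by omega⟩⟩
  have hc : 0 < ((contexts S H).card : ℝ) := by
    exact_mod_cast Finset.card_pos.2 (contexts_nonempty hH hS)
  have key : ∀ p (i : Fin K), ∀ s ∈ contexts S H, ∑ θ : Fin M × Fin S → Fin m,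
      armProb hH hS hΔ hΔ' cls m alg K (fun g => θ g)
        (fun w => (((w i).1 p s : Fin A) : ℕ) = θ (cls p, s)) ≤
      ∑ θ : Fin M × Fin S → Fin m, 3 / 4 := by
    intro p i s hs
    have h := sum_sum_update (β := Fin m) (cls p, s) fun θ =>
      armProb hH hS hΔ hΔ' cls m alg K (fun g => θ g)
        (fun w => (((w i).1 p s : Fin A) : ℕ) = θ (cls p, s))
    rw [Fintype.card_fin] at h
    rw [← mul_le_mul_iff_of_pos_left hm0, ← h, Finset.mul_sum]
    refine Finset.sum_le_sum fun θ _ => ?_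
    have h1 := sum_armProb_update_le hH hS hΔ hΔ' cls hm hmA hB hΔK alg (fun g => θ g) p i hs
    rw [mul_comm]
    refine le_trans (le_of_eq (Finset.sum_congr rfl fun a _ => ?_)) h1
    have h2 : (fun g => ((Function.update θ (cls p, s) a g : Fin m) : ℕ)) =
        Function.update (fun g => (θ g : ℕ)) (cls p, s) (a : ℕ) := by
      funext g
      by_cases hg : g = (cls p, s)
      · subst hg; simp
      · simp [hg]
    rw [h2, Function.update_self]
  obtain ⟨θ, -, hθ⟩ := Finset.exists_le_of_sum_le (s := Finset.univ)
    (f := fun _ : Fin M × Fin S → Fin m => ((H - 1 : ℕ) * Δ * M * K / 4 : ℝ))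
    (g := fun θ => (armEnv hH hS m hΔ hΔ' cls fun g => θ g).expectedRegret alg K)
    Finset.univ_nonempty (by
      refine le_trans ?_ (Finset.sum_le_sum fun θ _ =>
        expectedRegret_armEnv_ge hH hS hΔ hΔ' cls hm hmA alg θ)
      rw [Finset.sum_comm]
      have h1 : ∀ (p : Fin M) (i : Fin K), ∀ s ∈ contexts S H,
          ∑ θ : Fin M × Fin S → Fin m, ((contexts S H).card : ℝ)⁻¹ * ((H - 1 : ℕ) * Δ / 4) ≤
          ∑ θ : Fin M × Fin S → Fin m,
            ((contexts S H).card : ℝ)⁻¹ * ((H - 1 : ℕ) * (Δ * (1 - armProb hH hS hΔ hΔ' cls m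
              alg K (fun g => θ g) fun w => (((w i).1 p s : Fin A) : ℕ) = θ (cls p, s)))) := by
        intro p i s hs
        have h2 := key p i s hs
        simp only [← Finset.mul_sum]
        refine mul_le_mul_of_nonneg_left ?_ (by positivity)
        rw [Finset.sum_sub_distrib]
        simp only [Finset.sum_const, nsmul_eq_mul, mul_one] at h2 ⊢
        have h3 : 0 ≤ (H - 1 : ℕ) * Δ := by positivity
        nlinarith [mul_le_mul_of_nonneg_left h2 h3]
      calc _ = ∑ p : Fin M, ∑ i : Fin K, ∑ s ∈ contexts S H, ∑ θ : Fin M × Fin S → Fin m,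
            ((contexts S H).card : ℝ)⁻¹ * ((H - 1 : ℕ) * Δ / 4) := by
            simp only [Finset.sum_const, nsmul_eq_mul, Finset.card_univ, Fintype.card_fin]
            field_simp
        _ ≤ _ := by
          refine Finset.sum_le_sum fun p _ => le_trans ?_ (le_of_eq Finset.sum_comm)
          refine Finset.sum_le_sum fun i _ => le_trans ?_ (le_of_eq Finset.sum_comm)
          exact Finset.sum_le_sum fun s hs => h1 p i s hs)
  exact ⟨θ, hθ⟩

end HiddenArms

/-! ### The choice of the parameters -/

/-- The bias is `√(N * m / (K * B)) / 8`: up to a constant, the largest that goes undetected when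
`B` players spread `K` episodes each over `N * m` arms. -/
lemma exists_bias {N m K B M : ℕ} (hB : 0 < B) (hK : 0 < K) (hNm : 0 < N * m)
    (hle : N * m ≤ K) (H : ℕ) (hH : 2 ≤ H) :
    ∃ Δ : ℝ, 0 < Δ ∧ Δ ≤ 1 / 4 ∧ 64 * Δ ^ 2 * (K * B) ≤ N * m ∧
      √((H : ℝ) ^ 2 * M ^ 2 * (N * m) * K / B) / 64 ≤ (H - 1 : ℕ) * Δ * M * K / 4 := by
  have hB' : (1 : ℝ) ≤ B := by exact_mod_cast hB
  have hK' : (0 : ℝ) < K := by exact_mod_cast hK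
  have hN' : (0 : ℝ) < N * m := by exact_mod_cast hNm
  have hle' : (N * m : ℝ) ≤ K := by exact_mod_cast hle
  have hsq : √(N * m / (K * B) : ℝ) ^ 2 = N * m / (K * B) := Real.sq_sqrt (by positivity)
  refine ⟨√(N * m / (K * B)) / 8, by positivity, ?_, ?_, ?_⟩
  · have : √(N * m / (K * B) : ℝ) ≤ 1 := by
      rw [Real.sqrt_le_one, div_le_one (by positivity)]
      nlinarith
    linarith
  · rw [div_pow, hsq]
    field_simp
    linarith
  · rw [Nat.cast_sub (by omega), Nat.cast_one]
    have hH' : (2 : ℝ) ≤ H := by exact_mod_cast hH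
    have h1 : √((H : ℝ) ^ 2 * M ^ 2 * (N * m) * K / B) =
        H * M * K * √(N * m / (K * B)) := by
      rw [Real.sqrt_eq_iff_mul_self_eq (by positivity) (by
        have := Nat.cast_nonneg (α := ℝ) M
        positivity)]
      rw [show (H * M * K * √(N * m / (K * B)) * (H * M * K * √(N * m / (K * B))) : ℝ) =
        H ^ 2 * M ^ 2 * K ^ 2 * √(N * m / (K * B)) ^ 2 by ring, hsq]
      field_simp
    rw [h1]
    have h2 : 0 ≤ M * K * √(N * m / (K * B) : ℝ) := by positivity
    nlinarith

/-- The two terms of the lower bound are each at most `√(2 * U) ≤ 3 / 2 * √U`. -/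
lemma bound_of_le {c x y U R : ℝ} (hc : c = 1 / 256) (hx : x ≤ 2 * U) (hy : y ≤ 2 * U)
    (hR : √U / 64 ≤ R) (hU : 0 ≤ U) : c * (√x + √y) ≤ R := by
  have h : ∀ z, z ≤ 2 * U → √z ≤ 3 / 2 * √U := by
    intro z hz
    rw [show 3 / 2 * √U = √((3 / 2) ^ 2 * U) by
      rw [Real.sqrt_mul (by positivity), Real.sqrt_sq (by positivity)]]
    exact Real.sqrt_le_sqrt (by nlinarith)
  have h1 := h x hx
  have h2 := h y hy
  have := Real.sqrt_nonneg U
  subst hc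
  linarith

lemma gap_armEnv {S A H M m : ℕ} {Δ : ℝ} (hH : 2 ≤ H) (hS : 4 * H ≤ S) (hΔ : 0 ≤ Δ)
    (hΔ' : Δ ≤ 1 / 4) (cls : Fin M → Fin M) (hm : 0 < m) (hmA : m ≤ A)
    (θ : Fin M × Fin S → Fin m) (p : Fin M) {s : Fin S} (hs : s ∈ contexts S H) (a : Fin A) :
    (armEnv hH hS m hΔ hΔ' cls fun g => θ g).gap p s a =
      (H - 1 : ℕ) * (1 / 2 + Δ - armMean m Δ cls (fun g => θ g) p s a) := by
  have : Nonempty (Fin A) := ⟨⟨0, by omega⟩⟩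
  obtain ⟨h1, h2⟩ := armMean_isMax hΔ hmA cls θ p s hs
  exact gap_eq_of_isMax hH hS _ p a hs h1 h2

section Cases

variable {A H S K M l lC : ℕ} (hA : 2 ≤ A) (hH : 2 ≤ H) (hS : 4 * H ≤ S) (hK : S * A ≤ K)
  (hM : 1 ≤ M) (hl : l + lC = S * A)

include hA hH hS hK hM hl

/-- If the pairs in which the players may differ dominate, every player has best actions of its
own, and `l` pairs are bad by a margin that exceeds the dissimilarity of the players. -/
lemma exists_hard_of_le (hl4 : l + 4 * S + 4 * (H * A) ≤ S * A) (hle : l ≤ M * lC) :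
    ∃ ε : ℝ, 0 ≤ ε ∧ ∀ alg : Algorithm S A H M, ∃ I : Environment S A H M,
      I.IsDissimilar ε ∧ l ≤ (I.subpar (ε / (192 * H))).ncard ∧
      1 / 256 * (√((M : ℝ) ^ 2 * ((H : ℝ) ^ 2 * lC * K)) + √((M : ℝ) * (H : ℝ) ^ 2 * l * K))
        ≤ I.expectedRegret alg K := by
  obtain ⟨N, hN⟩ : ∃ N, N = (contexts S H).card := ⟨_, rfl⟩
  have hN' : N + 2 * (H - 1) = S := by rw [hN, card_contexts hS]; omega
  have hN0 : 0 < N := by omega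
  have hNA : N * A + 2 * ((H - 1) * A) = S * A := by rw [← hN']; ring
  have hHA : (H - 1) * A + A = H * A := by
    rw [← Nat.succ_mul]; congr 1; omega
  -- In each context, `b` actions are known to be bad.
  obtain ⟨b, hb1, hb2⟩ : ∃ b, l ≤ N * b ∧ N * b ≤ l + N := by
    refine ⟨l / N + 1, ?_, ?_⟩
    · exact (Nat.lt_mul_div_succ l hN0).le
    · rw [mul_add, mul_one]
      exact Nat.add_le_add_right (Nat.mul_div_le l N) N
  have hbA : b + 3 ≤ A := by
    refine Nat.le_of_mul_le_mul_left ?_ hN0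
    rw [mul_add]
    omega
  obtain ⟨m, rfl⟩ : ∃ m, A = b + m := ⟨A - b, by omega⟩
  have hNm : N * (b + m) = N * b + N * m := mul_add _ _ _
  have hNm0 : 0 < N * m := Nat.mul_pos hN0 (by omega)
  obtain ⟨Δ, hΔ0, hΔ, hΔK, hR⟩ := exists_bias (N := N) (m := m) (K := K) (B := 1) (M := M)
    one_pos (by omega) hNm0 (by omega) H hH
  have hHR : (2 : ℝ) ≤ H := by exact_mod_cast hH
  refine ⟨2 * H * Δ, by positivity, fun alg => ?_⟩
  obtain ⟨θ, hθ⟩ := exists_expectedRegret_ge (K := K) hH hS hΔ0.le hΔ id (m := m) (B := 1)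
    (by omega) (by omega) (fun c => by simp [Finset.filter_eq']) (by rw [← hN]; exact hΔK) alg
  refine ⟨_, ?_, ?_, bound_of_le rfl ?_ ?_ (hR.trans hθ) (by positivity)⟩
  · refine isDissimilar_banditEnv hH hS _ hΔ0.le fun p p' s a => ?_
    simp only [armMean]
    split_ifs <;> simp [abs_of_pos hΔ0, hΔ0.le]
  · have hsub : ((contexts S H ×ˢ (Finset.univ.filter fun a : Fin (b + m) => m ≤ (a : ℕ)) :
        Finset (Fin S × Fin (b + m))) : Set (Fin S × Fin (b + m))) ⊆
        (armEnv hH hS m hΔ0.le hΔ id fun g => θ g).subpar (2 * H * Δ / (192 * H)) := by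
      rintro ⟨s, a⟩ hsa
      simp only [Finset.coe_product, Finset.coe_filter, Finset.mem_univ, true_and, Set.mem_prod,
        Finset.mem_coe, Set.mem_ofPred_eq] at hsa
      refine ⟨⟨0, by omega⟩, ?_⟩
      rw [gap_armEnv hH hS hΔ0.le hΔ id (by omega) (by omega) θ _ hsa.1, armMean, if_pos hsa.2,
        Nat.cast_sub (by omega), Nat.cast_one]
      -- The gap is `(H - 1) * (1 / 2 + Δ)`, which exceeds `H * Δ` since `Δ < 1 / 2` and `H ≥ 2`.
      rw [show 96 * (H : ℝ) * (2 * H * Δ / (192 * H)) = H * Δ by field_simp; norm_num]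
      nlinarith
    refine le_trans ?_ (Set.ncard_le_ncard hsub (Set.toFinite _))
    rw [Set.ncard_coe_finset, Finset.card_product, ← hN]
    have hcard : (Finset.univ.filter fun a : Fin (b + m) => m ≤ (a : ℕ)).card = b := by
      have h : (Finset.univ.filter fun a : Fin (b + m) => m ≤ (a : ℕ)) =
          (Finset.univ.filter fun a : Fin (b + m) => (a : ℕ) < m)ᶜ := by
        ext; simp
      rw [h, Finset.card_compl, Fintype.card_fin, Fin.card_filter_val_lt]
      omega
    rw [hcard]
    exact hb1
  · have h : (lC : ℝ) ≤ 2 * (N * m) := by exact_mod_cast (by omega : lC ≤ 2 * (N * m))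
    have h0 : 0 ≤ (M : ℝ) ^ 2 * H ^ 2 * K := by positivity
    have := mul_le_mul_of_nonneg_left h h0
    rw [Nat.cast_one, div_one]
    linarith
  · have h : (lC : ℝ) ≤ 2 * (N * m) := by exact_mod_cast (by omega : lC ≤ 2 * (N * m))
    have h1 : (l : ℝ) ≤ M * lC := by exact_mod_cast hle
    have h0 : 0 ≤ (M : ℝ) ^ 2 * H ^ 2 * K := by positivity
    have h2 : 0 ≤ (M : ℝ) * H ^ 2 * K := by positivity
    have := mul_le_mul_of_nonneg_left h h0
    have := mul_le_mul_of_nonneg_left h1 h2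
    rw [Nat.cast_one, div_one]
    linarith

/-- If the pairs in which the players must behave alike dominate, all players face the same
environment, and all but the best action of each context are subpar. -/
lemma exists_hard_of_ge (hl4 : l + 4 * S + 4 * (H * A) ≤ S * A) (hle : M * lC ≤ l) :
    ∃ ε : ℝ, 0 ≤ ε ∧ ∀ alg : Algorithm S A H M, ∃ I : Environment S A H M,
      I.IsDissimilar ε ∧ l ≤ (I.subpar (ε / (192 * H))).ncard ∧
      1 / 256 * (√((M : ℝ) ^ 2 * ((H : ℝ) ^ 2 * lC * K)) + √((M : ℝ) * (H : ℝ) ^ 2 * l * K))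
        ≤ I.expectedRegret alg K := by
  obtain ⟨N, hN⟩ : ∃ N, N = (contexts S H).card := ⟨_, rfl⟩
  have hN' : N + 2 * (H - 1) = S := by rw [hN, card_contexts hS]; omega
  have hN0 : 0 < N := by omega
  have hNA : N * A + 2 * ((H - 1) * A) = S * A := by rw [← hN']; ring
  have hHA : (H - 1) * A + A = H * A := by
    rw [← Nat.succ_mul]; congr 1; omega
  have hNA0 : 0 < N * A := Nat.mul_pos hN0 (by omega)
  have hMR : (1 : ℝ) ≤ M := by exact_mod_cast hM
  obtain ⟨Δ, hΔ0, hΔ, hΔK, hR⟩ := exists_bias (N := N) (m := A) (K := K) (B := M) (M := M)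
    (by omega) (by omega) hNA0 (by omega) H hH
  have hHR : (2 : ℝ) ≤ H := by exact_mod_cast hH
  refine ⟨2 * H * 0, by simp, fun alg => ?_⟩
  obtain ⟨θ, hθ⟩ := exists_expectedRegret_ge (K := K) hH hS hΔ0.le hΔ
    (fun _ => ⟨0, by omega⟩) (m := A) (B := M) hA le_rfl
    (fun c => (Finset.card_le_univ _).trans (Fintype.card_fin M).le) (by rw [← hN]; exact hΔK) alg
  have hU : (H : ℝ) ^ 2 * M ^ 2 * (N * A) * K / M = H ^ 2 * M * (N * A) * K := by
    field_simp
  have hlN : (l : ℝ) ≤ 2 * (N * A) := by exact_mod_cast (by omega : l ≤ 2 * (N * A))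
  refine ⟨_, ?_, ?_, bound_of_le rfl ?_ ?_ (hR.trans hθ) (by positivity)⟩
  · refine isDissimilar_banditEnv hH hS _ le_rfl fun p p' s a => ?_
    simp [armMean]
  · have hsub : (((contexts S H ×ˢ Finset.univ) \
        (contexts S H).image fun s => (s, θ (⟨0, by omega⟩, s)) : Finset (Fin S × Fin A)) :
        Set (Fin S × Fin A)) ⊆
        (armEnv hH hS A hΔ0.le hΔ (fun _ => ⟨0, by omega⟩) fun g => θ g).subpar
          (2 * H * 0 / (192 * H)) := by
      rintro ⟨s, a⟩ hsa
      simp only [Finset.mem_coe, Finset.mem_sdiff, Finset.mem_product, Finset.mem_univ, and_true,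
        Finset.mem_image, Prod.mk.injEq, not_exists, not_and] at hsa
      refine ⟨⟨0, by omega⟩, ?_⟩
      have hne : (a : ℕ) ≠ θ (⟨0, by omega⟩, s) := fun h =>
        hsa.2 s hsa.1 rfl (Fin.ext h.symm)
      rw [gap_armEnv hH hS hΔ0.le hΔ _ (by omega) le_rfl θ _ hsa.1, armMean,
        if_neg (by simp), if_neg hne, Nat.cast_sub (by omega), Nat.cast_one]
      simp only [mul_zero, zero_div, add_sub_cancel_left]
      nlinarith
    refine le_trans ?_ (Set.ncard_le_ncard hsub (Set.toFinite _))
    rw [Set.ncard_coe_finset]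
    refine le_trans ?_ (Finset.le_card_sdiff _ _)
    have h1 := Finset.card_image_le (s := contexts S H)
      (f := fun s => (s, θ (⟨0, by omega⟩, s)))
    rw [Finset.card_product, Finset.card_univ, Fintype.card_fin, ← hN]
    rw [← hN] at h1
    omega
  · have h1 : (M * lC : ℝ) ≤ l := by exact_mod_cast hle
    have h0 : 0 ≤ (M : ℝ) * H ^ 2 * K := by positivity
    have := mul_le_mul_of_nonneg_left (h1.trans hlN) h0
    rw [hU]
    linarith
  · have h0 : 0 ≤ (M : ℝ) * H ^ 2 * K := by positivity
    have := mul_le_mul_of_nonneg_left hlN h0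
    rw [hU]
    linarith

end Cases

end MPERL

end

theorem theorem3 :
    ∃ c : ℝ, 0 < c ∧
      ∀ A H S K M l lC : ℕ, 2 ≤ A → 2 ≤ H → 4 * H ≤ S → S * A ≤ K → 1 ≤ M →
        l + lC = S * A → (l : ℤ) ≤ (S : ℤ) * A - 4 * ((S : ℤ) + H * A) →
        ∃ ε : ℝ, 0 ≤ ε ∧
          ∀ alg : MPERL.Algorithm S A H M,
            ∃ I : MPERL.Environment S A H M,
              I.IsDissimilar ε ∧
              l ≤ (I.subpar (ε / (192 * H))).ncard ∧
              c * (M * √((H : ℝ) ^ 2 * lC * K) + √((M : ℝ) * (H : ℝ) ^ 2 * l * K))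
                ≤ I.expectedRegret alg K := by
  refine ⟨1 / 256, by norm_num, ?_⟩
  intro A H S K M l lC hA hH hS hK hM hl hl'
  have hl4 : l + 4 * S + 4 * (H * A) ≤ S * A := by
    zify
    linarith
  have hM2 : ∀ x : ℝ, M * √x = √((M : ℝ) ^ 2 * x) := fun x => by
    rw [Real.sqrt_mul (by positivity), Real.sqrt_sq (by positivity)]
  simp only [hM2]
  rcases le_total l (M * lC) with hle | hle
  · exact MPERL.exists_hard_of_le hA hH hS hK hM hl hl4 hle
  · exact MPERL.exists_hard_of_ge hA hH hS hK hM hl hl4 hle
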